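/- **Setting.** Let $\Gamma$ be a finite simplicial graph with vertex set $V$, and let $A_\Gamma=\langle V\mid [v,w]=1 \text{ if } v,w \text{ are adjacent}\rangle$ be its right-angled Artin group, with Salvetti complex $\mathbb S$. Write $lk(v)$, $st(v)=lk(v)\cup\{v\}$ for the link and star of a vertex, and $v\le w$ if $lk(v)\subseteq st(w)$; put $V^{\pm}=\{v,v^{-1}\mid v\in V\}$ and extend adjacency and $\le$ to $V^\pm$ through the underlying vertices. *Marked Salvettis.* Let $Out_\ell(A_\Gamma)\le Out(A_\Gamma)$ be the subgroup generated by graph automorphisms, inversions, partial conjugations and non-adjacent transvections $v\mapsto vw$ ($v\neq w$ non-adjacent, $v\le w$). A marked Salvetti is an equivalence class $\sigma=(\mathbb S,\alpha)$, $\alpha\in Out_\ell(A_\Gamma)$ (identified with a homotopy class of homotopy equivalences $\mathbb S\to\mathbb S$), where $(\mathbb S,\alpha)\sim(\mathbb S,\alpha')$ if $\alpha=\alpha'\circ h$ for some $h$ induced by an isomorphism of the cube complex $\mathbb S$, i.e. some $h$ in the subgroup generated by graph automorphisms and inversions. *Whitehead moves.* A $\Gamma$-Whitehead pair $(P,m)$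 consists of $P\subset V^\pm$ with at least two elements and $m\in P$ with $m^{-1}\notin P$ such that (1) no element of $P$ is adjacent to $m$; (2) if $x\in P$ and $x^{-1}\notin P$, then $x\le m$; (3) if $v,v^{-1}\in P$, then $w,w^{-1}\in P$ for all $w$ in the component of $v$ in $\Gamma\setminus st(m)$. It determines the automorphism $\phi=(P,m)$ of $A_\Gamma$ with $\phi(m)=m^{-1}$ and, for the other vertices $v$, $\phi(v)=vm^{-1}$ if $v\in P$, $v^{-1}\notin P$; $\phi(v)=mv$ if $v^{-1}\in P$, $v\notin P$; $\phi(v)=mvm^{-1}$ if $v,v^{-1}\in P$; and $\phi(v)=v$ otherwise. The Whitehead move $(P,m)$ from $\sigma=(\mathbb S,\alpha)$ leads to the marked Salvetti $\sigma^{P}_m=(\mathbb S,\alpha\circ\phi)$; the representative $\alpha$ of $\sigma$ may be chosen separately for each move. A Whitehead path is a finite sequence of marked Salvettis each of which is obtained from the previous one by a Whitehead move. *Norm.* For a conjugacy class $g$ of $A_\Gamma$ and $\sigma=(\mathbb S,\alpha)$ let $\ell_\sigma(g)$ be the minimal length of a word in $V^\pm$ representing an element of $\alpha^{-1}(g)$.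 Fix a list $(g_1,g_2,\dots)$ of all conjugacy classes of $A_\Gamma$ (repetitions allowed), and let $\mathcal G_0$ be the finite set of those represented by words of length at most $2$. The norm of $\sigma$ is $\|\sigma\|=\bigl(\sum_{g\in\mathcal G_0}\ell_\sigma(g),\,\ell_\sigma(g_1),\,\ell_\sigma(g_2),\dots\bigr)$, and norms are compared lexicographically. A Whitehead move $(P,v)$ from $\sigma$ is reductive if $\|\sigma^P_v\|<\|\sigma\|$. **Theorem (Peak Reduction).** Let $\sigma$ be a marked Salvetti and let $(P,v)$ and $(Q,w)$ be two reductive Whitehead moves from $\sigma$. Then there is a Whitehead path from $\sigma^P_v$ to $\sigma^Q_w$ that passes only through marked Salvettis $\tau$ with $\|\tau\|<\|\sigma\|$. -/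

import Mathlib

universe u

noncomputable section

open scoped Classical commutatorElement

/-! ### Right-angled Artin groups -/

/-- The right-angled Artin group `A_Γ`: generators the vertices of `Γ`, and `[v, w] = 1` whenever
`v` and `w` are adjacent. -/
abbrev RAAG {V : Type u} (Γ : SimpleGraph V) : Type u :=
  PresentedGroup {r : FreeGroup V | ∃ v w, Γ.Adj v w ∧ r = ⁅FreeGroup.of v, FreeGroup.of w⁆}

namespace RAAG

/-- The generator of `A_Γ` given by a vertex. -/
def gen {V : Type u} (Γ : SimpleGraph V) (v : V) : RAAG Γ := PresentedGroup.of v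

/-- Elements of `V^±` are pairs `(v, b)`: `(v, true)` is `v` and `(v, false)` is `v⁻¹`.
This is the formal inverse on `V^±`. -/
def letterInv {V : Type u} (x : V × Bool) : V × Bool := (x.1, !x.2)

/-- An element of `V^±` as an element of `A_Γ`. -/
def letter {V : Type u} (Γ : SimpleGraph V) (x : V × Bool) : RAAG Γ :=
  if x.2 = true then gen Γ x.1 else (gen Γ x.1)⁻¹

/-- The element of `A_Γ` represented by a word in `V^±`. -/
def evalWord {V : Type u} (Γ : SimpleGraph V) (w : List (V × Bool)) : RAAG Γ :=
  (w.map (letter Γ)).prod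

/-- The star of a vertex: the vertex together with its link `Γ.neighborSet v`. -/
def vertexStar {V : Type u} (Γ : SimpleGraph V) (v : V) : Set V := insert v (Γ.neighborSet v)

/-- The relation `v ≤ w` on vertices: `lk(v) ⊆ st(w)`. -/
def LinkLE {V : Type u} (Γ : SimpleGraph V) (v w : V) : Prop := Γ.neighborSet v ⊆ vertexStar Γ w

/-- `v` and `w` lie in the same connected component of `Γ ∖ st(m)`. -/
def SameComponent {V : Type u} (Γ : SimpleGraph V) (m v w : V) : Prop :=
  ∃ (hv : v ∈ (vertexStar Γ m)ᶜ) (hw : w ∈ (vertexStar Γ m)ᶜ),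
    (Γ.induce (vertexStar Γ m)ᶜ).Reachable ⟨v, hv⟩ ⟨w, hw⟩

theorem commute_gen {V : Type u} {Γ : SimpleGraph V} {v w : V} (h : Γ.Adj v w) :
    Commute (gen Γ v) (gen Γ w) := by
  have h1 : PresentedGroup.mk
      {r : FreeGroup V | ∃ v w, Γ.Adj v w ∧ r = ⁅FreeGroup.of v, FreeGroup.of w⁆}
      ⁅FreeGroup.of v, FreeGroup.of w⁆ = 1 :=
    PresentedGroup.one_of_mem ⟨v, w, h, rfl⟩
  rw [map_commutatorElement] at h1
  exact commutatorElement_eq_one_iff_commute.1 h1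

theorem commute_letter {V : Type u} {Γ : SimpleGraph V} {v : V} {m : V × Bool}
    (h : Γ.Adj v m.1) : Commute (gen Γ v) (letter Γ m) := by
  unfold letter
  split_ifs
  · exact commute_gen h
  · exact (commute_gen h).inv_right

theorem aut_ext {V : Type u} {Γ : SimpleGraph V} {φ ψ : MulAut (RAAG Γ)}
    (h : ∀ v, φ (gen Γ v) = ψ (gen Γ v)) : φ = ψ := by
  have : (φ : RAAG Γ ≃* RAAG Γ).toMonoidHom = (ψ : RAAG Γ ≃* RAAG Γ).toMonoidHom :=
    PresentedGroup.ext h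
  ext x
  exact DFunLike.congr_fun this x

/-! ### Outer automorphisms and the group `Out_ℓ(A_Γ)` -/

/-- The subgroup of inner automorphisms. -/
def inner (G : Type u) [Group G] : Subgroup (MulAut G) := (MulAut.conj : G →* MulAut G).range

instance (G : Type u) [Group G] : (inner G).Normal where
  conj_mem := by
    rintro _ ⟨a, rfl⟩ φ
    refine ⟨φ a, ?_⟩
    ext x
    simp [MulAut.conj_apply, MulAut.mul_apply]

/-- The outer automorphism group. -/
abbrev Out (G : Type u) [Group G] : Type u := MulAut G ⧸ inner G

/-- The outer automorphism class of an automorphism. -/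
def toOut (G : Type u) [Group G] : MulAut G →* Out G := QuotientGroup.mk' (inner G)

/-- Graph automorphisms. -/
def IsGraphAut {V : Type u} (Γ : SimpleGraph V) (φ : MulAut (RAAG Γ)) : Prop :=
  ∃ π : Γ ≃g Γ, ∀ v, φ (gen Γ v) = gen Γ (π v)

/-- Inversions. -/
def IsInversion {V : Type u} (Γ : SimpleGraph V) (φ : MulAut (RAAG Γ)) : Prop :=
  ∃ v, φ (gen Γ v) = (gen Γ v)⁻¹ ∧ ∀ u, u ≠ v → φ (gen Γ u) = gen Γ u

/-- Non-adjacent transvections `v ↦ v w`, where `v ≤ w`. -/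
def IsNonadjTransvection {V : Type u} (Γ : SimpleGraph V) (φ : MulAut (RAAG Γ)) : Prop :=
  ∃ v w, v ≠ w ∧ ¬ Γ.Adj v w ∧ LinkLE Γ v w ∧
    φ (gen Γ v) = gen Γ v * gen Γ w ∧ ∀ u, u ≠ v → φ (gen Γ u) = gen Γ u

/-- Partial conjugations: conjugation by `v` on a component `C` of `Γ ∖ st(v)`. -/
def IsPartialConj {V : Type u} (Γ : SimpleGraph V) (φ : MulAut (RAAG Γ)) : Prop :=
  ∃ (v : V) (C : (Γ.induce (vertexStar Γ v)ᶜ).ConnectedComponent),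
    (∀ x ∈ (Subtype.val '' C.supp : Set V), φ (gen Γ x) = gen Γ v * gen Γ x * (gen Γ v)⁻¹) ∧
    (∀ x ∉ (Subtype.val '' C.supp : Set V), φ (gen Γ x) = gen Γ x)

/-- The generators of the long-range automorphism group. -/
def longRangeGens {V : Type u} (Γ : SimpleGraph V) : Set (MulAut (RAAG Γ)) :=
  {φ | IsGraphAut Γ φ ∨ IsInversion Γ φ ∨ IsPartialConj Γ φ ∨ IsNonadjTransvection Γ φ}

/-- `Out_ℓ(A_Γ)`: the subgroup of `Out(A_Γ)` generated by graph automorphisms, inversions, partial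
conjugations and non-adjacent transvections. -/
def OutL {V : Type u} (Γ : SimpleGraph V) : Subgroup (Out (RAAG Γ)) :=
  Subgroup.closure (toOut (RAAG Γ) '' longRangeGens Γ)

/-- The (finite) subgroup of `Out(A_Γ)` generated by graph automorphisms and inversions, i.e. the
outer automorphisms that are induced by isomorphisms `𝕊 → 𝕊` of the Salvetti complex `𝕊` of `Γ`:
such an isomorphism is a permutation of the set `V^±` of oriented edges that commutes with
orientation reversal and preserves adjacency. -/
def salvettiIso {V : Type u} (Γ : SimpleGraph V) : Subgroup (Out (RAAG Γ)) :=
  Subgroup.closure (toOut (RAAG Γ) '' {φ | IsGraphAut Γ φ ∨ IsInversion Γ φ})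

/-! ### Whitehead pairs and their automorphisms -/

/-- A pair `(P, m)` that satisfies the conditions for a `Γ`-Whitehead pair, except that `P` may be
a singleton (a possibly degenerate pair). -/
structure DegenerateOrWhiteheadPair {V : Type u} (Γ : SimpleGraph V) where
  P : Set (V × Bool)
  m : V × Bool
  m_mem : m ∈ P
  letterInv_m_notMem : letterInv m ∉ P
  not_adj : ∀ x ∈ P, ¬ Γ.Adj x.1 m.1
  single_le : ∀ x ∈ P, letterInv x ∉ P → LinkLE Γ x.1 m.1
  double_mem : ∀ v, (v, true) ∈ P → (v, false) ∈ P → ∀ w, SameComponent Γ m.1 v w →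
    (w, true) ∈ P ∧ (w, false) ∈ P

/-- A `Γ`-Whitehead pair: `P` has at least two elements. -/
structure WhiteheadPair {V : Type u} (Γ : SimpleGraph V) extends
    DegenerateOrWhiteheadPair Γ where
  nontrivial : P.Nontrivial

/-- The image of a generator under the Whitehead automorphism `(P, m)`. -/
def whiteheadImage {V : Type u} (Γ : SimpleGraph V) (P : Set (V × Bool)) (m : V × Bool) (v : V) :
    RAAG Γ :=
  if v = m.1 then (gen Γ v)⁻¹
  else if (v, true) ∈ P ∧ (v, false) ∉ P then gen Γ v * (letter Γ m)⁻¹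
  else if (v, false) ∈ P ∧ (v, true) ∉ P then letter Γ m * gen Γ v
  else if (v, true) ∈ P ∧ (v, false) ∈ P then letter Γ m * gen Γ v * (letter Γ m)⁻¹
  else gen Γ v

theorem whiteheadImage_self {V : Type u} (Γ : SimpleGraph V) (P : Set (V × Bool)) (m : V × Bool) :
    whiteheadImage Γ P m m.1 = (gen Γ m.1)⁻¹ := by simp [whiteheadImage]

theorem whiteheadImage_of_ne {V : Type u} (Γ : SimpleGraph V) (P : Set (V × Bool)) (m : V × Bool)
    {v : V} (h : v ≠ m.1) : whiteheadImage Γ P m v =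
      (if (v, false) ∈ P then letter Γ m else 1) * gen Γ v *
        (if (v, true) ∈ P then (letter Γ m)⁻¹ else 1) := by
  unfold whiteheadImage
  by_cases h1 : (v, true) ∈ P <;> by_cases h2 : (v, false) ∈ P <;> simp [h, h1, h2]

theorem bool_pair_cases {V : Type u} (x : V × Bool) : x = (x.1, true) ∨ x = (x.1, false) := by
  obtain ⟨v, b⟩ := x
  cases b <;> simp

namespace DegenerateOrWhiteheadPair

variable {V : Type u} {Γ : SimpleGraph V}

theorem eq_m (p : DegenerateOrWhiteheadPair Γ) {x : V × Bool} (hx : x ∈ p.P) (h : x.1 = p.m.1) :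
    x = p.m := by
  have hf := p.letterInv_m_notMem
  obtain ⟨v, b⟩ := x
  obtain ⟨P, ⟨w, c⟩, _⟩ := p
  simp only at h
  subst h
  cases b <;> cases c <;> simp_all [letterInv]

theorem sameComponent_of_adj {m v w : V} (h : Γ.Adj v w) (hv : v ∉ vertexStar Γ m)
    (hw : w ∉ vertexStar Γ m) : SameComponent Γ m v w :=
  ⟨hv, hw, SimpleGraph.Adj.reachable (by simpa using h)⟩

theorem sameComponent_symm {m v w : V} (h : SameComponent Γ m v w) : SameComponent Γ m w v :=
  let ⟨hv, hw, r⟩ := h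
  ⟨hw, hv, r.symm⟩

theorem sameComponent_trans {m v w x : V} (h : SameComponent Γ m v w)
    (h' : SameComponent Γ m w x) : SameComponent Γ m v x :=
  let ⟨hv, _, r⟩ := h
  let ⟨_, hx, r'⟩ := h'
  ⟨hv, hx, r.trans r'⟩

theorem notMem_of_adj_m (p : DegenerateOrWhiteheadPair Γ) {v : V} (h : Γ.Adj v p.m.1) (b : Bool) :
    (v, b) ∉ p.P := fun hx => p.not_adj _ hx h

theorem letterInv_mem_of_adj (p : DegenerateOrWhiteheadPair Γ) {v w : V} (h : Γ.Adj v w)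
    (hw : w ∉ vertexStar Γ p.m.1) (b : Bool) (hb : (v, b) ∈ p.P) : (v, !b) ∈ p.P := by
  by_contra hc
  exact hw (p.single_le _ hb hc h)

theorem mem_of_adj (p : DegenerateOrWhiteheadPair Γ) {v w : V} (h : Γ.Adj v w)
    (hv : v ∉ vertexStar Γ p.m.1) (hw : w ∉ vertexStar Γ p.m.1) (b c : Bool) (hb : (v, b) ∈ p.P) :
    (w, c) ∈ p.P := by
  have h2 := p.letterInv_mem_of_adj h hw b hb
  have h3 : (v, true) ∈ p.P ∧ (v, false) ∈ p.P := by cases b <;> simp_all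
  have := p.double_mem v h3.1 h3.2 w (sameComponent_of_adj h hv hw)
  cases c <;> simp [this]

theorem whiteheadImage_of_adj_m (p : DegenerateOrWhiteheadPair Γ) {v : V} (h : Γ.Adj v p.m.1) :
    whiteheadImage Γ p.P p.m v = gen Γ v := by
  rw [whiteheadImage_of_ne _ _ _ h.ne]
  simp [p.notMem_of_adj_m h]

theorem commute_of_adj_m (p : DegenerateOrWhiteheadPair Γ) {v w : V} (h : Γ.Adj v p.m.1)
    (hvw : Γ.Adj v w) :
    Commute (whiteheadImage Γ p.P p.m v) (whiteheadImage Γ p.P p.m w) := by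
  rw [p.whiteheadImage_of_adj_m h]
  have h1 := commute_gen hvw
  have h2 := commute_letter h
  by_cases hw : w = p.m.1
  · subst hw
    rw [whiteheadImage_self]
    exact h1.inv_right
  · rw [whiteheadImage_of_ne _ _ _ hw]
    refine (Commute.mul_right ?_ h1).mul_right ?_
    · split_ifs
      · exact h2
      · exact Commute.one_right _
    · split_ifs
      · exact h2.inv_right
      · exact Commute.one_right _

theorem commute_whiteheadImage (p : DegenerateOrWhiteheadPair Γ) {v w : V} (h : Γ.Adj v w) :
    Commute (whiteheadImage Γ p.P p.m v) (whiteheadImage Γ p.P p.m w) := by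
  by_cases hv : Γ.Adj v p.m.1
  · exact p.commute_of_adj_m hv h
  by_cases hw : Γ.Adj w p.m.1
  · exact (p.commute_of_adj_m hw h.symm).symm
  have hvm : v ≠ p.m.1 := by
    rintro rfl
    exact hw h.symm
  have hwm : w ≠ p.m.1 := by
    rintro rfl
    exact hv h
  have hv' : v ∉ vertexStar Γ p.m.1 := by
    simp only [vertexStar, Set.mem_insert_iff, SimpleGraph.mem_neighborSet, not_or]
    exact ⟨hvm, fun h => hv h.symm⟩
  have hw' : w ∉ vertexStar Γ p.m.1 := by
    simp only [vertexStar, Set.mem_insert_iff, SimpleGraph.mem_neighborSet, not_or]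
    exact ⟨hwm, fun h => hw h.symm⟩
  rw [whiteheadImage_of_ne _ _ _ hvm, whiteheadImage_of_ne _ _ _ hwm]
  by_cases hP : ∃ b, (v, b) ∈ p.P
  · obtain ⟨b, hb⟩ := hP
    have hwP : ∀ c, (w, c) ∈ p.P := fun c => p.mem_of_adj h hv' hw' b c hb
    have hvP : ∀ c, (v, c) ∈ p.P := fun c => p.mem_of_adj h.symm hw' hv' true c (hwP _)
    rw [if_pos (hvP _), if_pos (hvP _), if_pos (hwP _), if_pos (hwP _)]
    exact (Commute.conj_iff _).2 (commute_gen h)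
  · have hvP : ∀ c, (v, c) ∉ p.P := by simpa using hP
    have hwP : ∀ c, (w, c) ∉ p.P := fun c hc => hvP true (p.mem_of_adj h.symm hw' hv' c true hc)
    rw [if_neg (hvP _), if_neg (hvP _), if_neg (hwP _), if_neg (hwP _)]
    simp only [one_mul, mul_one]
    exact commute_gen h

/-- The Whitehead automorphism of `A_Γ`, as an endomorphism. -/
def hom (p : DegenerateOrWhiteheadPair Γ) : RAAG Γ →* RAAG Γ :=
  PresentedGroup.toGroup (f := whiteheadImage Γ p.P p.m) (by
    rintro _ ⟨v, w, h, rfl⟩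
    rw [map_commutatorElement, FreeGroup.lift_apply_of, FreeGroup.lift_apply_of]
    exact commutatorElement_eq_one_iff_commute.2 (p.commute_whiteheadImage h))

theorem hom_gen (p : DegenerateOrWhiteheadPair Γ) (v : V) :
    p.hom (gen Γ v) = whiteheadImage Γ p.P p.m v :=
  PresentedGroup.toGroup.of _

theorem hom_letter_m (p : DegenerateOrWhiteheadPair Γ) :
    p.hom (letter Γ p.m) = (letter Γ p.m)⁻¹ := by
  unfold letter
  split_ifs <;> simp [hom_gen, whiteheadImage_self]

theorem hom_hom (p : DegenerateOrWhiteheadPair Γ) : p.hom.comp p.hom = MonoidHom.id _ := by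
  refine PresentedGroup.ext fun v => ?_
  change p.hom (p.hom (gen Γ v)) = gen Γ v
  by_cases hv : v = p.m.1
  · subst hv
    simp [hom_gen, whiteheadImage_self]
  · rw [hom_gen, whiteheadImage_of_ne _ _ _ hv, map_mul, map_mul, hom_gen,
      whiteheadImage_of_ne _ _ _ hv]
    split_ifs <;> simp [hom_letter_m, mul_assoc]

/-- The Whitehead automorphism `(P, m)` of `A_Γ`. -/
def aut (p : DegenerateOrWhiteheadPair Γ) : MulAut (RAAG Γ) :=
  MonoidHom.toMulEquiv p.hom p.hom p.hom_hom p.hom_hom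

theorem aut_gen (p : DegenerateOrWhiteheadPair Γ) (v : V) :
    p.aut (gen Γ v) = whiteheadImage Γ p.P p.m v := p.hom_gen v

/-! Whitehead automorphisms are long-range. -/

/-- The degenerate pair `({m}, m)`, whose automorphism is the inversion of `m`. -/
def inv (Γ : SimpleGraph V) (m : V × Bool) : DegenerateOrWhiteheadPair Γ where
  P := {m}
  m := m
  m_mem := rfl
  letterInv_m_notMem := by
    obtain ⟨v, b⟩ := m
    simp [letterInv]
  not_adj := by
    rintro x rfl
    exact Γ.irrefl
  single_le := by
    rintro x rfl -
    exact Set.subset_insert _ _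
  double_mem := by
    rintro v h1 h2
    rw [Set.mem_singleton_iff] at h1 h2
    simp [← h1] at h2

theorem inv_aut_self (m : V × Bool) : (inv Γ m).aut (gen Γ m.1) = (gen Γ m.1)⁻¹ := by
  rw [aut_gen]
  exact whiteheadImage_self _ _ _

theorem inv_aut_of_ne (m : V × Bool) {u : V} (hu : u ≠ m.1) :
    (inv Γ m).aut (gen Γ u) = gen Γ u := by
  have h : ∀ b, (u, b) ∉ (inv Γ m).P := by
    rintro b hb
    exact hu (congrArg Prod.fst (Set.mem_singleton_iff.1 hb))
  rw [aut_gen, whiteheadImage_of_ne _ _ (inv Γ m).m hu]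
  simp [h]

theorem isInversion_inv (m : V × Bool) : IsInversion Γ (inv Γ m).aut :=
  ⟨m.1, inv_aut_self m, fun _ hu => inv_aut_of_ne m hu⟩

theorem inv_mem (m : V × Bool) : (inv Γ m).aut ∈ Subgroup.closure (longRangeGens Γ) :=
  Subgroup.subset_closure (Or.inr (Or.inl (isInversion_inv m)))

theorem inv_aut_letter (m : V × Bool) : (inv Γ m).aut (letter Γ m) = (letter Γ m)⁻¹ :=
  (inv Γ m).hom_letter_m

theorem aut_letter (p : DegenerateOrWhiteheadPair Γ) :
    p.aut (letter Γ p.m) = (letter Γ p.m)⁻¹ := p.hom_letter_m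

/-- A Whitehead automorphism factors along a decomposition of `P`. -/
theorem aut_factor (p q r : DegenerateOrWhiteheadPair Γ) (hq : q.m = p.m) (hr : r.m = p.m)
    (hP : ∀ x, x ≠ p.m → (x ∈ p.P ↔ x ∈ q.P ∨ x ∈ r.P))
    (hd : ∀ x, x ≠ p.m → x ∈ q.P → x ∉ r.P) :
    p.aut = q.aut * (inv Γ p.m).aut * r.aut := by
  refine aut_ext fun v => ?_
  rw [MulAut.mul_apply, MulAut.mul_apply]
  by_cases hv : v = p.m.1
  · have h1 : r.aut (gen Γ v) = (gen Γ v)⁻¹ := by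
      rw [aut_gen, hv, ← hr, whiteheadImage_self]
    have h2 : q.aut (gen Γ v) = (gen Γ v)⁻¹ := by
      rw [aut_gen, hv, ← hq, whiteheadImage_self]
    have h3 : p.aut (gen Γ v) = (gen Γ v)⁻¹ := by
      rw [aut_gen, hv, whiteheadImage_self]
    have h4 : (inv Γ p.m).aut (gen Γ v) = (gen Γ v)⁻¹ := by
      rw [hv, inv_aut_self]
    rw [h1, map_inv, h4, map_inv, map_inv, h2, h3, inv_inv]
  · have ne : ∀ b, (v, b) ≠ p.m := fun b h => hv (congrArg Prod.fst h)
    have e1 := inv_aut_letter (Γ := Γ) p.m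
    have e2 := q.aut_letter
    rw [hq] at e2
    rw [aut_gen, aut_gen, whiteheadImage_of_ne _ _ _ hv,
      whiteheadImage_of_ne _ _ _ (by rwa [hr] : v ≠ r.m.1), hr]
    simp only [map_mul, inv_aut_of_ne _ hv, aut_gen q]
    rw [whiteheadImage_of_ne _ _ _ (by rwa [hq] : v ≠ q.m.1), hq]
    have a1 := hP _ (ne true)
    have a2 := hP _ (ne false)
    have a3 := hd _ (ne true)
    have a4 := hd _ (ne false)
    by_cases b1 : (v, true) ∈ q.P <;> by_cases b2 : (v, false) ∈ q.P <;>
    by_cases b3 : (v, true) ∈ r.P <;> by_cases b4 : (v, false) ∈ r.P <;>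
    simp_all [mul_assoc]

theorem single_piece_mem (q : DegenerateOrWhiteheadPair Γ) (x : V × Bool) (hx : x.1 ≠ q.m.1)
    (hq : q.P = {x, q.m}) : q.aut ∈ Subgroup.closure (longRangeGens Γ) := by
  obtain ⟨v, b⟩ := x
  have hle : LinkLE Γ v q.m.1 := by
    refine q.single_le (v, b) (by simp [hq]) ?_
    rw [hq, Set.mem_insert_iff, Set.mem_singleton_iff, not_or]
    exact ⟨by simp [letterInv], fun h => hx (congrArg Prod.fst (Set.mem_singleton_iff.1 h : ((v, !b) : V × Bool) = q.m) :)⟩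
  have hadj : ¬ Γ.Adj v q.m.1 := q.not_adj (v, b) (by simp [hq])
  have hother : ∀ u, u ≠ v → u ≠ q.m.1 → q.aut (gen Γ u) = gen Γ u := by
    intro u h1 h2
    have : ∀ c, (u, c) ∉ q.P := by
      intro c
      rw [hq, Set.mem_insert_iff, Set.mem_singleton_iff, not_or]
      exact ⟨fun h => h1 (congrArg Prod.fst h), fun h => h2 (congrArg Prod.fst h)⟩
    rw [aut_gen, whiteheadImage_of_ne _ _ _ h2]
    simp [this]
  have hm : q.aut (gen Γ q.m.1) = (gen Γ q.m.1)⁻¹ := by rw [aut_gen, whiteheadImage_self]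
  have hqm : ∀ c, (v, c) ≠ q.m := fun c h => hx (congrArg Prod.fst (show (v, c) = q.m from h) :)
  have hxv : q.aut (gen Γ v) = if b = true then gen Γ v * (letter Γ q.m)⁻¹
      else letter Γ q.m * gen Γ v := by
    rw [aut_gen, whiteheadImage_of_ne _ _ _ hx, hq]
    cases b <;> simp [hqm]
  -- it is enough to correct by inversions
  suffices h : ∃ A ∈ Subgroup.closure (longRangeGens Γ), ∃ B ∈ Subgroup.closure (longRangeGens Γ),
      IsNonadjTransvection Γ (A * q.aut * B) by
    obtain ⟨A, hA, B, hB, h⟩ := h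
    have h' : A * q.aut * B ∈ Subgroup.closure (longRangeGens Γ) :=
      Subgroup.subset_closure (Or.inr (Or.inr (Or.inr h)))
    rwa [Subgroup.mul_mem_cancel_right _ hB, Subgroup.mul_mem_cancel_left _ hA] at h'
  obtain ⟨w, hw⟩ : ∃ w, w = q.m.1 := ⟨_, rfl⟩
  have im := inv_mem (Γ := Γ) q.m
  have iv := inv_mem (Γ := Γ) (v, b)
  have im1 := inv_aut_self (Γ := Γ) q.m
  have iv1 := inv_aut_self (Γ := Γ) (v, b)
  have im2 := fun u hu => inv_aut_of_ne (Γ := Γ) q.m (u := u) hu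
  have iv2 := fun u hu => inv_aut_of_ne (Γ := Γ) (v, b) (u := u) hu
  simp only at iv1 iv2
  have hl : letter Γ q.m = if q.m.2 = true then gen Γ w else (gen Γ w)⁻¹ := by rw [hw]; rfl
  rw [hl] at hxv
  rw [← hw] at hx hle hadj hother hm im1 im2
  have hx' := hx.symm
  generalize (inv Γ q.m).aut = I at *
  generalize (inv Γ (v, b)).aut = J at *
  generalize q.aut = φ at *
  cases b <;> rcases Bool.eq_false_or_eq_true q.m.2 with hb | hb <;>
    simp only [hb, if_true, if_false, Bool.false_eq_true, inv_inv] at hxv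
  · refine ⟨I * J, mul_mem im iv, J, iv, v, w, hx, hadj, hle, ?_, fun u hu => ?_⟩
    · simp [MulAut.mul_apply, iv1, hxv, iv2 w hx', im1, im2 v hx]
    · by_cases huw : u = w
      · subst huw
        simp [MulAut.mul_apply, iv2 u hx', hm, im1]
      · simp [MulAut.mul_apply, iv2 u hu, hother u hu huw, im2 u huw]
  · refine ⟨J, iv, J * I, mul_mem iv im, v, w, hx, hadj, hle, ?_, fun u hu => ?_⟩
    · simp [MulAut.mul_apply, iv1, hxv, iv2 w hx', im2 v hx]
    · by_cases huw : u = w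
      · subst huw
        simp [MulAut.mul_apply, iv2 u hx', hm, im1]
      · simp [MulAut.mul_apply, iv2 u hu, hother u hu huw, im2 u huw]
  · refine ⟨I, im, 1, one_mem _, v, w, hx, hadj, hle, ?_, fun u hu => ?_⟩
    · simp [MulAut.mul_apply, hxv, im1, im2 v hx]
    · by_cases huw : u = w
      · subst huw
        simp [MulAut.mul_apply, hm, im1]
      · simp [MulAut.mul_apply, hother u hu huw, im2 u huw]
  · refine ⟨1, one_mem _, I, im, v, w, hx, hadj, hle, ?_, fun u hu => ?_⟩
    · simp [MulAut.mul_apply, hxv, im2 v hx]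
    · by_cases huw : u = w
      · subst huw
        simp [MulAut.mul_apply, hm, im1]
      · simp [MulAut.mul_apply, hother u hu huw, im2 u huw]

theorem double_piece_mem (q : DegenerateOrWhiteheadPair Γ) (x : V)
    (hxm : x ∈ (vertexStar Γ q.m.1)ᶜ)
    (hq : ∀ y, y ≠ q.m → (y ∈ q.P ↔ SameComponent Γ q.m.1 x y.1)) :
    q.aut ∈ Subgroup.closure (longRangeGens Γ) := by
  let C := (Γ.induce (vertexStar Γ q.m.1)ᶜ).connectedComponentMk ⟨x, hxm⟩
  have hC : ∀ v, v ∈ (Subtype.val '' C.supp : Set V) ↔ SameComponent Γ q.m.1 x v := by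
    intro v
    constructor
    · rintro ⟨⟨w, hw⟩, h, rfl⟩
      exact ⟨hxm, hw, (SimpleGraph.ConnectedComponent.exact h).symm⟩
    · rintro ⟨_, hw, h⟩
      exact ⟨⟨v, hw⟩, SimpleGraph.ConnectedComponent.sound h.symm, rfl⟩
  have hmC : ∀ v, SameComponent Γ q.m.1 x v → v ≠ q.m.1 := by
    rintro v ⟨_, hw, -⟩ rfl
    exact hw (Set.mem_insert _ _)
  have h1 : ∀ v, SameComponent Γ q.m.1 x v →
      q.aut (gen Γ v) = letter Γ q.m * gen Γ v * (letter Γ q.m)⁻¹ := by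
    intro v hv
    have : ∀ c, (v, c) ∈ q.P := fun c =>
      (hq (v, c) (fun h => hmC v hv (congrArg Prod.fst h))).2 hv
    rw [aut_gen, whiteheadImage_of_ne _ _ _ (hmC v hv)]
    simp [this]
  have h2 : ∀ v, v ≠ q.m.1 → ¬ SameComponent Γ q.m.1 x v → q.aut (gen Γ v) = gen Γ v := by
    intro v hvm hv
    have : ∀ c, (v, c) ∉ q.P := fun c hc =>
      hv ((hq (v, c) (fun h => hvm (congrArg Prod.fst h))).1 hc)
    rw [aut_gen, whiteheadImage_of_ne _ _ _ hvm]
    simp [this]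
  have hm : q.aut (gen Γ q.m.1) = (gen Γ q.m.1)⁻¹ := by rw [aut_gen, whiteheadImage_self]
  have im := inv_mem (Γ := Γ) q.m
  have im1 := inv_aut_self (Γ := Γ) q.m
  have im2 := fun u hu => inv_aut_of_ne (Γ := Γ) q.m (u := u) hu
  suffices h : ∃ A ∈ Subgroup.closure (longRangeGens Γ), ∃ B ∈ Subgroup.closure (longRangeGens Γ),
      IsPartialConj Γ (A * q.aut * B) by
    obtain ⟨A, hA, B, hB, h⟩ := h
    have h' : A * q.aut * B ∈ Subgroup.closure (longRangeGens Γ) :=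
      Subgroup.subset_closure (Or.inr (Or.inr (Or.inl h)))
    rwa [Subgroup.mul_mem_cancel_right _ hB, Subgroup.mul_mem_cancel_left _ hA] at h'
  have hmm : ¬ SameComponent Γ q.m.1 x q.m.1 := fun h => hmC _ h rfl
  rcases Bool.eq_false_or_eq_true q.m.2 with hb | hb
  · have hl : letter Γ q.m = gen Γ q.m.1 := by simp [letter, hb]
    rw [hl] at h1
    refine ⟨1, one_mem _, _, im, q.m.1, C, fun v hv => ?_, fun v hv => ?_⟩
    · rw [hC] at hv
      simp [MulAut.mul_apply, im2 v (hmC v hv), h1 v hv]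
    · rw [hC] at hv
      by_cases hvm : v = q.m.1
      · subst hvm
        simp [MulAut.mul_apply, im1, hm]
      · simp [MulAut.mul_apply, im2 v hvm, h2 v hvm hv]
  · have hl : letter Γ q.m = (gen Γ q.m.1)⁻¹ := by simp [letter, hb]
    rw [hl] at h1
    refine ⟨_, im, 1, one_mem _, q.m.1, C, fun v hv => ?_, fun v hv => ?_⟩
    · rw [hC] at hv
      simp [MulAut.mul_apply, im2 v (hmC v hv), h1 v hv, im1]
    · rw [hC] at hv
      by_cases hvm : v = q.m.1
      · subst hvm
        simp [MulAut.mul_apply, im1, hm]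
      · simp [MulAut.mul_apply, im2 v hvm, h2 v hvm hv]

/-- The pair `({x, m}, m)` for `x ∈ single(P)`. -/
def singlePiece (p : DegenerateOrWhiteheadPair Γ) (x : V × Bool) (hx : x ∈ p.P)
    (hx' : letterInv x ∉ p.P) : DegenerateOrWhiteheadPair Γ where
  P := {x, p.m}
  m := p.m
  m_mem := by simp
  letterInv_m_notMem := by
    rintro (h | h)
    · exact p.letterInv_m_notMem (h ▸ hx)
    · exact absurd (congrArg Prod.snd (Set.mem_singleton_iff.1 h)) (by simp [letterInv])
  not_adj := by
    rintro y (rfl | rfl)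
    · exact p.not_adj _ hx
    · exact p.not_adj _ p.m_mem
  single_le := by
    rintro y (rfl | rfl) -
    · exact p.single_le _ hx hx'
    · exact Set.subset_insert _ _
  double_mem := by
    intro v h1 h2
    have s1 : (v, true) ∈ p.P := by
      rcases h1 with h | h
      · exact h ▸ hx
      · exact Set.mem_singleton_iff.1 h ▸ p.m_mem
    have s2 : (v, false) ∈ p.P := by
      rcases h2 with h | h
      · exact h ▸ hx
      · exact Set.mem_singleton_iff.1 h ▸ p.m_mem
    exfalso
    rcases h1 with h | h
    · exact hx' (h ▸ s2)
    · exact p.letterInv_m_notMem (Set.mem_singleton_iff.1 h ▸ s2)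

/-- The pair `(P ∖ {x}, m)` for `x ∈ single(P)`. -/
def singleRest (p : DegenerateOrWhiteheadPair Γ) (x : V × Bool)
    (hxm : x ≠ p.m) (hx' : letterInv x ∉ p.P) : DegenerateOrWhiteheadPair Γ where
  P := p.P \ {x}
  m := p.m
  m_mem := ⟨p.m_mem, fun h => hxm (Set.mem_singleton_iff.1 h).symm⟩
  letterInv_m_notMem := fun h => p.letterInv_m_notMem h.1
  not_adj := fun y hy => p.not_adj y hy.1
  single_le := by
    intro y hy hy'
    refine p.single_le y hy.1 fun h => hy' ⟨h, fun h2 => hx' ?_⟩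
    rw [← Set.mem_singleton_iff.1 h2]
    simpa [letterInv] using hy.1
  double_mem := by
    intro v h1 h2 w hw
    have h := p.double_mem v h1.1 h2.1 w hw
    refine ⟨⟨h.1, fun e => hx' ?_⟩, ⟨h.2, fun e => hx' ?_⟩⟩
    · rw [← Set.mem_singleton_iff.1 e]
      exact h.2
    · rw [← Set.mem_singleton_iff.1 e]
      exact h.1

theorem notMem_star_of_double (p : DegenerateOrWhiteheadPair Γ) {v : V}
    (h : ∀ b, (v, b) ∈ p.P) : v ∈ (vertexStar Γ p.m.1)ᶜ := by
  rintro (rfl | h2)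
  · exact p.letterInv_m_notMem (h _)
  · exact p.not_adj _ (h true) (SimpleGraph.Adj.symm h2)

/-- The pair `(C^± ∪ {m}, m)` for the component `C` of an element of `double(P)`. -/
def doublePiece (p : DegenerateOrWhiteheadPair Γ) (x : V) : DegenerateOrWhiteheadPair Γ where
  P := {y | y = p.m ∨ SameComponent Γ p.m.1 x y.1}
  m := p.m
  m_mem := Or.inl rfl
  letterInv_m_notMem := by
    rintro (h | ⟨_, h, -⟩)
    · exact absurd (congrArg Prod.snd h) (by simp [letterInv])
    · exact h (Set.mem_insert _ _)
  not_adj := by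
    rintro y (rfl | ⟨_, h, -⟩) h'
    · exact Γ.irrefl h'
    · exact h (Or.inr h'.symm)
  single_le := by
    rintro y (rfl | h) h'
    · exact Set.subset_insert _ _
    · exact absurd (Or.inr h) h'
  double_mem := by
    intro v h1 h2 w hw
    have hv : SameComponent Γ p.m.1 x v := by
      rcases h1 with h1 | h1
      · rcases h2 with h2 | h2
        · rw [← h1] at h2
          simp at h2
        · exact h2
      · exact h1
    exact ⟨Or.inr (sameComponent_trans hv hw), Or.inr (sameComponent_trans hv hw)⟩

/-- The pair `(P ∖ C^±, m)` for the component `C` of an element of `double(P)`. -/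
def doubleRest (p : DegenerateOrWhiteheadPair Γ) (x : V) : DegenerateOrWhiteheadPair Γ where
  P := {y | y ∈ p.P ∧ ¬ SameComponent Γ p.m.1 x y.1}
  m := p.m
  m_mem := ⟨p.m_mem, fun ⟨_, h, _⟩ => h (Set.mem_insert _ _)⟩
  letterInv_m_notMem := fun h => p.letterInv_m_notMem h.1
  not_adj := fun y hy => p.not_adj y hy.1
  single_le := fun y hy hy' => p.single_le y hy.1 fun h => hy' ⟨h, hy.2⟩
  double_mem := by
    intro v h1 h2 w hw
    have h := p.double_mem v h1.1 h2.1 w hw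
    have hn : ¬ SameComponent Γ p.m.1 x w := fun hc =>
      h1.2 (sameComponent_trans hc (sameComponent_symm hw))
    exact ⟨⟨h.1, hn⟩, ⟨h.2, hn⟩⟩

theorem aut_mem [Finite V] (p : DegenerateOrWhiteheadPair Γ) :
    p.aut ∈ Subgroup.closure (longRangeGens Γ) := by
  obtain ⟨n, hn⟩ : ∃ n, n = p.P.ncard := ⟨_, rfl⟩
  induction n using Nat.strong_induction_on generalizing p with
  | _ n ih =>
    by_cases hP : ∃ x ∈ p.P, x ≠ p.m
    · obtain ⟨x, hx, hxm⟩ := hP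
      have hx1 : x.1 ≠ p.m.1 := fun h => hxm (p.eq_m hx h)
      by_cases hx' : letterInv x ∈ p.P
      · have hxb : ∀ b, (x.1, b) ∈ p.P := by
          intro b
          obtain ⟨v, c⟩ := x
          cases b <;> cases c <;> simp_all [letterInv]
        have hC := p.notMem_star_of_double hxb
        have hsub : (p.doubleRest x.1).P ⊂ p.P := by
          refine ⟨fun y hy => hy.1, fun h => (h hx).2 ⟨hC, hC, .refl _⟩⟩
        rw [p.aut_factor (p.doublePiece x.1) (p.doubleRest x.1) rfl rfl]
        · refine mul_mem (mul_mem ?_ (inv_mem _)) (ih _ ?_ _ rfl)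
          · refine double_piece_mem _ x.1 hC fun y hy => ?_
            exact ⟨fun h => h.resolve_left hy, Or.inr⟩
          · rw [hn]
            exact Set.ncard_lt_ncard hsub
        · intro y hy
          constructor
          · intro h
            by_cases hc : SameComponent Γ p.m.1 x.1 y.1
            · exact Or.inl (Or.inr hc)
            · exact Or.inr ⟨h, hc⟩
          · rintro (h | h)
            · have := p.double_mem x.1 (hxb _) (hxb _) y.1 (h.resolve_left hy)
              rcases bool_pair_cases y with e | e <;> rw [e]
              · exact this.1
              · exact this.2
            · exact h.1
        · intro y hy h h'
          exact h'.2 (h.resolve_left hy)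
      · have hsub : (p.singleRest x hxm hx').P ⊂ p.P :=
          ⟨fun y hy => hy.1, fun h => (h hx).2 rfl⟩
        rw [p.aut_factor (p.singlePiece x hx hx') (p.singleRest x hxm hx') rfl rfl]
        · refine mul_mem (mul_mem ?_ (inv_mem _)) (ih _ ?_ _ rfl)
          · exact single_piece_mem _ x hx1 rfl
          · rw [hn]
            exact Set.ncard_lt_ncard hsub
        · intro y hy
          constructor
          · intro h
            by_cases hc : y = x
            · exact Or.inl (Or.inl hc)
            · exact Or.inr ⟨h, hc⟩
          · rintro ((h | h) | h)
            · exact h ▸ hx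
            · exact absurd h hy
            · exact h.1
        · rintro y hy (h | h) h'
          · exact h'.2 h
          · exact hy h
    · have hP' : p.P = (inv Γ p.m).P := by
        ext y
        constructor
        · intro h
          by_contra hc
          exact hP ⟨y, h, hc⟩
        · intro h
          exact Set.mem_singleton_iff.1 h ▸ p.m_mem
      have : p.aut = (inv Γ p.m).aut := by
        refine aut_ext fun v => ?_
        rw [aut_gen, aut_gen, hP']
        rfl
      rw [this]
      exact inv_mem _

end DegenerateOrWhiteheadPair

/-- The element of `Out_ℓ(A_Γ)` given by a `Γ`-Whitehead pair. -/
def WhiteheadPair.toOutL {V : Type u} [Finite V] {Γ : SimpleGraph V} (p : WhiteheadPair Γ) :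
    OutL Γ :=
  ⟨toOut (RAAG Γ) p.aut, by
    rw [OutL, ← MonoidHom.map_closure]
    exact Subgroup.mem_map_of_mem _ p.aut_mem⟩

/-! ### Lengths of conjugacy classes -/

/-- The action of `Out(G)` on the conjugacy classes of `G`. -/
def outAct {G : Type u} [Group G] (α : Out G) (c : ConjClasses G) : ConjClasses G :=
  Quotient.liftOn' α (fun φ : MulAut G => c.map φ.toMonoidHom) (by
    intro φ ψ h
    rw [QuotientGroup.leftRel_apply] at h
    obtain ⟨a, ha⟩ := h
    have hψ : ψ = φ * MulAut.conj a := by rw [ha]; group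
    induction c using Quotient.inductionOn with
    | _ x =>
      refine ConjClasses.mk_eq_mk_iff_isConj.2 ?_
      rw [isConj_iff]
      refine ⟨φ a, ?_⟩
      rw [hψ]
      simp [MulAut.mul_apply])

theorem outAct_toOut_mk {G : Type u} [Group G] (φ : MulAut G) (x : G) :
    outAct (toOut G φ) (ConjClasses.mk x) = ConjClasses.mk (φ x) := rfl

theorem outAct_mul {G : Type u} [Group G] (α β : Out G) (c : ConjClasses G) :
    outAct (α * β) c = outAct α (outAct β c) := by
  induction α using QuotientGroup.induction_on with
  | _ φ =>
    induction β using QuotientGroup.induction_on with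
    | _ ψ =>
      induction c using Quotient.inductionOn with
      | _ x => rfl

theorem outAct_one {G : Type u} [Group G] (c : ConjClasses G) : outAct (1 : Out G) c = c := by
  induction c using Quotient.inductionOn with
  | _ x => rfl

/-- The minimal length of a word in `V^±` that represents an element of a conjugacy class. -/
def classLength {V : Type u} (Γ : SimpleGraph V) (c : ConjClasses (RAAG Γ)) : ℕ :=
  sInf {n | ∃ w : List (V × Bool), w.length = n ∧ ConjClasses.mk (evalWord Γ w) = c}

theorem classLength_outAct_of_perm {V : Type u} {Γ : SimpleGraph V} (φ : MulAut (RAAG Γ))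
    (f : Equiv.Perm (V × Bool)) (h : ∀ x, φ (letter Γ x) = letter Γ (f x))
    (c : ConjClasses (RAAG Γ)) :
    classLength Γ (outAct (toOut (RAAG Γ) φ) c) = classLength Γ c := by
  have hw : ∀ w : List (V × Bool), φ (evalWord Γ w) = evalWord Γ (w.map f) := by
    intro w
    rw [evalWord, map_list_prod, evalWord, List.map_map, List.map_map]
    congr 1
    exact List.map_congr_left fun x _ => h x
  unfold classLength
  congr 1
  ext n
  constructor
  · rintro ⟨w, hn, hc⟩
    refine ⟨w.map f.symm, by simpa using hn, ?_⟩
    have h2 : ConjClasses.mk (evalWord Γ w) = outAct (toOut (RAAG Γ) φ)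
        (ConjClasses.mk (evalWord Γ (w.map f.symm))) := by
      rw [outAct_toOut_mk, hw, List.map_map]
      simp
    rw [h2] at hc
    have h3 := congrArg (outAct (toOut (RAAG Γ) φ)⁻¹) hc
    rwa [← outAct_mul, ← outAct_mul, inv_mul_cancel, outAct_one, outAct_one] at h3
  · rintro ⟨w, hn, rfl⟩
    exact ⟨w.map f, by simpa using hn, by rw [outAct_toOut_mk, hw]⟩

theorem classLength_outAct {V : Type u} {Γ : SimpleGraph V} {α : Out (RAAG Γ)}
    (hα : α ∈ salvettiIso Γ) (c : ConjClasses (RAAG Γ)) :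
    classLength Γ (outAct α c) = classLength Γ c := by
  unfold salvettiIso at hα
  induction hα using Subgroup.closure_induction generalizing c with
  | mem α h =>
    obtain ⟨φ, h | h, rfl⟩ := h
    · obtain ⟨π, hπ⟩ := h
      refine classLength_outAct_of_perm φ (Equiv.prodCongr π.toEquiv (Equiv.refl Bool)) ?_ c
      rintro ⟨v, b⟩
      cases b <;> simp [letter, hπ]
    · obtain ⟨v, h1, h2⟩ := h
      have hf : Function.Involutive
          (fun x : V × Bool => if x.1 = v then (x.1, !x.2) else x) := by
        rintro ⟨u, b⟩
        by_cases hu : u = v <;> simp [hu]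
      refine classLength_outAct_of_perm φ (Function.Involutive.toPerm _ hf) ?_ c
      rintro ⟨u, b⟩
      by_cases hu : u = v
      · have e : Function.Involutive.toPerm _ hf (u, b) = (u, !b) := if_pos hu
        rw [e]
        subst hu
        cases b <;> simp [letter, h1]
      · have e : Function.Involutive.toPerm _ hf (u, b) = (u, b) := if_neg hu
        rw [e]
        cases b <;> simp [letter, h2 u hu]
  | one => rw [outAct_one]
  | mul α β _ _ h1 h2 => rw [outAct_mul, h1, h2]
  | inv α _ h =>
    rw [← h (outAct α⁻¹ c), ← outAct_mul, mul_inv_cancel, outAct_one]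

/-! ### Marked Salvettis, their norm, and Whitehead moves -/

/-- Marked Salvettis: equivalence classes of pairs `(𝕊, α)` with `α ∈ Out_ℓ(A_Γ)`, regarded as the
homotopy class of a homotopy equivalence `𝕊 → 𝕊`, where `(𝕊, α) ∼ (𝕊, α')` if `α' ∘ h = α` for
the outer automorphism `h` induced by some isomorphism `𝕊 → 𝕊`. -/
abbrev MarkedSalvetti {V : Type u} (Γ : SimpleGraph V) : Type u :=
  OutL Γ ⧸ (salvettiIso Γ).subgroupOf (OutL Γ)

/-- The marked Salvetti represented by `(𝕊, α)`. -/
def MarkedSalvetti.mk {V : Type u} {Γ : SimpleGraph V} (α : OutL Γ) : MarkedSalvetti Γ :=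
  QuotientGroup.mk α

/-- `ℓ_σ(g)`: for `σ = (𝕊, α)`, the minimal length of a word representing `α⁻¹(g)`. -/
def MarkedSalvetti.length {V : Type u} {Γ : SimpleGraph V} (σ : MarkedSalvetti Γ)
    (g : ConjClasses (RAAG Γ)) : ℕ :=
  Quotient.liftOn' σ (fun α : OutL Γ => classLength Γ (outAct (α : Out (RAAG Γ))⁻¹ g)) (by
    intro α β h
    rw [QuotientGroup.leftRel_apply, Subgroup.mem_subgroupOf] at h
    have h2 : (α : Out (RAAG Γ))⁻¹ = ((α⁻¹ * β : OutL Γ) : Out (RAAG Γ)) * (β : Out (RAAG Γ))⁻¹ := by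
      push_cast
      group
    change classLength Γ (outAct (α : Out (RAAG Γ))⁻¹ g) =
      classLength Γ (outAct (β : Out (RAAG Γ))⁻¹ g)
    rw [h2, outAct_mul, classLength_outAct h])

/-- `𝒢₀`: the conjugacy classes represented by words of length at most `2`. -/
def shortClasses {V : Type u} (Γ : SimpleGraph V) : Set (ConjClasses (RAAG Γ)) :=
  {c | ∃ w : List (V × Bool), w.length ≤ 2 ∧ ConjClasses.mk (evalWord Γ w) = c}

theorem shortClasses_finite {V : Type u} [Finite V] (Γ : SimpleGraph V) :
    (shortClasses Γ).Finite :=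
  (List.finite_length_le (V × Bool) 2).image fun w => ConjClasses.mk (evalWord Γ w)

/-- The norm of `σ` with respect to a list `g 0, g 1, …` of conjugacy classes, in `ℤ × ℤ^ℕ` with
the lexicographic order. -/
def MarkedSalvetti.norm {V : Type u} [Finite V] {Γ : SimpleGraph V}
    (g : ℕ → ConjClasses (RAAG Γ)) (σ : MarkedSalvetti Γ) : ℤ ×ₗ Lex (ℕ → ℤ) :=
  toLex (∑ c ∈ (shortClasses_finite Γ).toFinset, (σ.length c : ℤ),
    toLex fun i => (σ.length (g i) : ℤ))

/-- The marked Salvetti `σ^P_v = (𝕊, α ∘ φ)` for `σ = (𝕊, α)` and the Whitehead automorphism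
`φ = (P, v)`. -/
def MarkedSalvetti.move {V : Type u} [Finite V] {Γ : SimpleGraph V} (α : OutL Γ)
    (p : WhiteheadPair Γ) : MarkedSalvetti Γ :=
  MarkedSalvetti.mk (α * p.toOutL)

/-- `τ` is obtained from `σ` by a Whitehead move. -/
def MarkedSalvetti.IsMove {V : Type u} [Finite V] {Γ : SimpleGraph V} (σ τ : MarkedSalvetti Γ) :
    Prop :=
  ∃ (α : OutL Γ) (p : WhiteheadPair Γ), MarkedSalvetti.mk α = σ ∧ MarkedSalvetti.move α p = τ

end RAAG

end

noncomputable section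

open scoped Classical

namespace RAAG

variable {V : Type u} {Γ : SimpleGraph V}

/-! ### Cyclic words -/

/-! Conjugacy classes are studied through cyclic words. Cancelling inverse letters, modulo rotation
and swaps of commuting letters, is confluent (`cancels_confluent`), so every word of a class reduces
to any shortest one. Hence a count that is invariant under swaps and rotation and does not grow when
an inverse pair is inserted backwards, that is, does not increase under cancellation, is minimised
by `minWord` (`CyclicMonotone.minWord_le`).

Two such counts determine how lengths change. The automorphism of a pair `(P, m)` preserves the
number of letters on every vertex other than that of `m`; the number on the vertex of `m` becomes
the number of times a shortest cyclic word crosses between `P` and its complement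
(`classCount_outAct_self`). The norm is additive in the lengths and takes values in a linearly
ordered abelian group, so a move reduces it exactly when the crossings weigh less than the
occurrences of the base vertex (`norm_move_lt_iff`).

Let `(P, v)` and `(Q, w)` be reductive. If `v` and `w` are adjacent, or if `P` and `Q` are disjoint
and one of them contains neither letter of the other's base vertex, the automorphisms fit into a
square whose norms satisfy a parallelogram identity (`norm_square`), and the fourth corner lies
below `σ`. If `P ⊆ Q` have the same base, the two results differ by one move. The general case rests
on submodularity: opposite corners of `P` and `Q` have together at most as many crossings as `P` and
`Q` (`classCrossings_corner_add_le`). If one corner contains a letter of `v` and the other a letter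
of `w`, one corner is reductive; it is nested in one set and disjoint from the complement of the
other, and complements give the same outer automorphism. When no such corners exist, `v` and `w`
split each other's sets and have equal links, and one pair can be rebased at the heavier of the two
vertices (`connected_of_split`). -/

theorem letterInv_letterInv (x : V × Bool) : letterInv (letterInv x) = x := by
  simp [letterInv]

theorem letterInv_ne (x : V × Bool) : letterInv x ≠ x := fun h => by
  have := congrArg Prod.snd h
  simp [letterInv] at this

theorem letter_letterInv (x : V × Bool) : letter Γ (letterInv x) = (letter Γ x)⁻¹ := by
  obtain ⟨v, b⟩ := x
  cases b <;> simp [letter, letterInv]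

theorem commute_letter_letter {x y : V × Bool} (h : Γ.Adj x.1 y.1) :
    Commute (letter Γ x) (letter Γ y) := by
  have := commute_letter (m := y) h
  unfold letter at this ⊢
  by_cases hx : x.2 = true
  · simpa [hx] using this
  · simpa [hx] using this

@[simp] theorem evalWord_nil : evalWord Γ [] = 1 := rfl

@[simp] theorem evalWord_cons (x : V × Bool) (l : List (V × Bool)) :
    evalWord Γ (x :: l) = letter Γ x * evalWord Γ l := by simp [evalWord]

@[simp] theorem evalWord_append (l l' : List (V × Bool)) :
    evalWord Γ (l ++ l') = evalWord Γ l * evalWord Γ l' := by simp [evalWord]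

/-- Words that differ by a swap of adjacent commuting letters or by moving the first letter to
the end. -/
inductive CyclicStep (Γ : SimpleGraph V) : List (V × Bool) → List (V × Bool) → Prop
  | swap (l₁ l₂ : List (V × Bool)) (y z : V × Bool) (h : Γ.Adj y.1 z.1) :
      CyclicStep Γ (l₁ ++ y :: z :: l₂) (l₁ ++ z :: y :: l₂)
  | rotate (y : V × Bool) (l : List (V × Bool)) : CyclicStep Γ (y :: l) (l ++ [y])

/-- The equivalence of cyclic words generated by swaps of commuting letters. -/
abbrev CyclicEquiv (Γ : SimpleGraph V) : List (V × Bool) → List (V × Bool) → Prop :=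
  Relation.ReflTransGen (CyclicStep Γ)

theorem cyclicEquiv_rotate (a b : List (V × Bool)) : CyclicEquiv Γ (a ++ b) (b ++ a) := by
  induction a generalizing b with
  | nil => simpa using Relation.ReflTransGen.refl
  | cons y a ih =>
    refine Relation.ReflTransGen.head (CyclicStep.rotate y (a ++ b)) ?_
    simpa using ih (b ++ [y])

theorem CyclicStep.symm {a b : List (V × Bool)} (h : CyclicStep Γ a b) : CyclicEquiv Γ b a := by
  cases h with
  | swap l₁ l₂ y z h => exact .single (.swap _ _ _ _ h.symm)
  | rotate y l => exact cyclicEquiv_rotate l [y]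

theorem CyclicEquiv.symm {a b : List (V × Bool)} (h : CyclicEquiv Γ a b) : CyclicEquiv Γ b a := by
  induction h with
  | refl => exact .refl
  | tail _ h ih => exact h.symm.trans ih

theorem cyclicEquiv_of_eqvGen {a b : List (V × Bool)} (h : Relation.EqvGen (CyclicStep Γ) a b) :
    CyclicEquiv Γ a b := by
  induction h with
  | rel _ _ h => exact .single h
  | refl => exact .refl
  | symm _ _ _ ih => exact CyclicEquiv.symm ih
  | trans _ _ _ _ _ ih ih' => exact ih.trans ih'

theorem cyclicEquiv_move (p l q : List (V × Bool)) (x : V × Bool)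
    (h : ∀ y ∈ l, Γ.Adj y.1 x.1) : CyclicEquiv Γ (p ++ x :: (l ++ q)) (p ++ l ++ x :: q) := by
  induction l generalizing p with
  | nil => simpa using Relation.ReflTransGen.refl
  | cons y l ih =>
    refine Relation.ReflTransGen.head (CyclicStep.swap p (l ++ q) x y (h y (by simp)).symm) ?_
    simpa using ih (p ++ [y]) fun z hz => h z (by simp [hz])

/-- `b` is obtained from the cyclic word `a` by deleting two mutually inverse letters that are
separated by letters commuting with them. -/
def Deletes (Γ : SimpleGraph V) (a b : List (V × Bool)) : Prop :=
  ∃ p l q x, a = p ++ x :: (l ++ letterInv x :: q) ∧ b = p ++ (l ++ q) ∧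
    ((∀ y ∈ l, Γ.Adj y.1 x.1) ∨ (∀ y ∈ p ++ q, Γ.Adj y.1 x.1))

/-- The alternatives in `Deletes` refer to the two arcs between the deleted letters on the circle.
Rotating a deleted letter to the end exchanges the arcs, so both must be allowed. -/
theorem deletes_rotate {y : V × Bool} {l b : List (V × Bool)} (h : Deletes Γ (y :: l) b) :
    ∃ b', Deletes Γ (l ++ [y]) b' ∧ CyclicEquiv Γ b b' := by
  obtain ⟨p, a, q, x, h1, rfl, h3⟩ := h
  cases p with
  | nil =>
    simp only [List.nil_append, List.cons.injEq] at h1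
    obtain ⟨rfl, rfl⟩ := h1
    refine ⟨a ++ q, ⟨a, q, [], letterInv y, ?_, by simp, ?_⟩, .refl⟩
    · simp [letterInv_letterInv]
    · rcases h3 with h | h
      · exact Or.inr fun w hw => h w (by simpa using hw)
      · exact Or.inl fun w hw => h w (by simpa using hw)
  | cons z p =>
    simp only [List.cons_append, List.cons.injEq] at h1
    obtain ⟨rfl, rfl⟩ := h1
    refine ⟨p ++ (a ++ q) ++ [y], ⟨p, a, q ++ [y], x, by simp, by simp, ?_⟩,
      .single (.rotate _ _)⟩
    rcases h3 with h | h
    · exact Or.inl h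
    · refine Or.inr fun z hz => h z ?_
      simp only [List.mem_append, List.mem_cons] at hz ⊢
      tauto

/-- The swapped letters cannot be the two deleted ones, since no vertex is adjacent to itself. So
the swap either avoids the deleted letters or carries a commuting letter across one of them into the
other arc; the same pair remains deletable. -/
theorem deletes_swap {y z : V × Bool} {l₁ l₂ b : List (V × Bool)} (hyz : Γ.Adj y.1 z.1)
    (h : Deletes Γ (l₁ ++ y :: z :: l₂) b) :
    ∃ b', Deletes Γ (l₁ ++ z :: y :: l₂) b' ∧ CyclicEquiv Γ b b' := by
  obtain ⟨p, a, q, x, h1, rfl, h3⟩ := h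
  have key : ∀ p' a' q' x', l₁ ++ z :: y :: l₂ = p' ++ x' :: (a' ++ letterInv x' :: q') →
      CyclicEquiv Γ (p ++ (a ++ q)) (p' ++ (a' ++ q')) →
      ((∀ w ∈ a, Γ.Adj w.1 x.1) → ∀ w ∈ a', Γ.Adj w.1 x'.1) →
      ((∀ w ∈ p ++ q, Γ.Adj w.1 x.1) → ∀ w ∈ p' ++ q', Γ.Adj w.1 x'.1) →
      ∃ b', Deletes Γ (l₁ ++ z :: y :: l₂) b' ∧ CyclicEquiv Γ (p ++ (a ++ q)) b' :=
    fun p' a' q' x' h e h4 h5 => ⟨_, ⟨p', a', q', x', h, rfl, h3.imp h4 h5⟩, e⟩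
  clear h3
  have nil_case : ∀ {z : V × Bool}, y = x → z :: l₂ = a ++ letterInv x :: q → Γ.Adj y.1 z.1 →
      ∃ a', a = z :: a' ∧ l₂ = a' ++ letterInv x :: q := by
    rintro z rfl h hz
    rcases a with _ | ⟨w, a⟩
    · simp only [List.nil_append, List.cons.injEq] at h
      obtain ⟨rfl, -⟩ := h
      exact absurd hz Γ.irrefl
    · simp only [List.cons_append, List.cons.injEq] at h
      obtain ⟨rfl, h⟩ := h
      exact ⟨a, rfl, h⟩
  have first_case : l₁ = p → y = x → z :: l₂ = a ++ letterInv x :: q →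
      ∃ b', Deletes Γ (l₁ ++ z :: y :: l₂) b' ∧ CyclicEquiv Γ (p ++ (a ++ q)) b' := by
    rintro rfl h4 h5
    obtain ⟨a', rfl, rfl⟩ := nil_case h4 h5 hyz
    subst h4
    refine key (l₁ ++ [z]) a' q y (by simp) (by simpa using Relation.ReflTransGen.refl)
      (fun h w hw => h w (by simp [hw])) fun h w hw => ?_
    simp only [List.append_assoc, List.mem_append, List.mem_singleton] at hw h
    rcases hw with hw | rfl | hw
    · exact h w (Or.inl hw)
    · exact hyz.symm
    · exact h w (Or.inr hw)
  have last_case : ∀ c, l₁ = p ++ x :: c → a = c → y = letterInv x → q = z :: l₂ →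
      ∃ b', Deletes Γ (l₁ ++ z :: y :: l₂) b' ∧ CyclicEquiv Γ (p ++ (a ++ q)) b' := by
    rintro _ rfl rfl rfl rfl
    refine key p (a ++ [z]) l₂ x (by simp) (by simpa using Relation.ReflTransGen.refl)
      (fun h w hw => ?_) fun h w hw => h w ?_
    · simp only [List.mem_append, List.mem_singleton] at hw
      rcases hw with hw | rfl
      · exact h w hw
      · exact hyz.symm
    · simp only [List.mem_append, List.mem_cons] at hw ⊢
      tauto
  rcases List.append_eq_append_iff.1 h1 with ⟨c, hp, h2⟩ | ⟨c, hl, h2⟩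
  · rcases c with _ | ⟨w, _ | ⟨w', c⟩⟩
    · simp only [List.nil_append, List.cons.injEq] at h2
      exact first_case (by simpa using hp.symm) h2.1 h2.2
    · simp only [List.cons_append, List.nil_append, List.cons.injEq] at h2
      obtain ⟨rfl, rfl, rfl⟩ := h2
      subst hp
      refine key l₁ (y :: a) q z (by simp) (by simpa using Relation.ReflTransGen.refl)
        (fun h w hw => ?_) fun h w hw => h w ?_
      · rcases List.mem_cons.1 hw with rfl | hw
        · exact hyz
        · exact h w hw
      · simp only [List.append_assoc, List.mem_append] at hw ⊢
        tauto
    · simp only [List.cons_append, List.cons.injEq] at h2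
      obtain ⟨rfl, rfl, rfl⟩ := h2
      subst hp
      refine key (l₁ ++ z :: y :: c) a q x (by simp)
        (.single (by simpa using CyclicStep.swap l₁ (c ++ (a ++ q)) y z hyz)) id
        fun h w hw => h w ?_
      simp only [List.append_assoc, List.mem_append, List.mem_cons, List.cons_append] at hw ⊢
      tauto
  · rcases c with _ | ⟨w, c⟩
    · simp only [List.nil_append, List.cons.injEq] at h2
      exact first_case (by simpa using hl) h2.1.symm h2.2.symm
    · simp only [List.cons_append, List.cons.injEq] at h2
      obtain ⟨rfl, h2⟩ := h2
      rcases List.append_eq_append_iff.1 h2 with ⟨d, hc, h4⟩ | ⟨d, ha, h4⟩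
      · rcases d with _ | ⟨w, d⟩
        · simp only [List.nil_append, List.cons.injEq] at h4
          exact last_case c hl (by simpa using hc.symm) h4.1.symm h4.2
        · simp only [List.cons_append, List.cons.injEq] at h4
          obtain ⟨rfl, rfl⟩ := h4
          subst hc hl
          refine key p a (d ++ z :: y :: l₂) x (by simp)
            (.single (by simpa using CyclicStep.swap (p ++ (a ++ d)) l₂ y z hyz)) id
            fun h w hw => h w ?_
          simp only [List.mem_append, List.mem_cons] at hw ⊢
          tauto
      · rcases d with _ | ⟨w, _ | ⟨w', d⟩⟩
        · simp only [List.nil_append, List.cons.injEq] at h4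
          exact last_case c hl (by simpa using ha) h4.1 h4.2.symm
        · simp only [List.cons_append, List.nil_append, List.cons.injEq] at h4
          obtain ⟨rfl, rfl, rfl⟩ := h4
          subst ha hl
          refine key p c (y :: l₂) x (by simp) (by simpa using Relation.ReflTransGen.refl)
            (fun h w hw => h w (by simp [hw])) fun h w hw => ?_
          simp only [List.mem_append, List.mem_cons] at hw h
          rcases hw with hw | rfl | hw
          · exact h w (Or.inl hw)
          · exact hyz
          · exact h w (Or.inr hw)
        · simp only [List.cons_append, List.cons.injEq] at h4
          obtain ⟨rfl, rfl, rfl⟩ := h4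
          subst ha hl
          refine key p (c ++ z :: y :: d) q x (by simp)
            (.single (by simpa using CyclicStep.swap (p ++ c) (d ++ q) y z hyz))
            (fun h w hw => h w ?_) id
          simp only [List.mem_append, List.mem_cons] at hw ⊢
          tauto

theorem deletes_cyclicEquiv {a a' b : List (V × Bool)} (h : Deletes Γ a b)
    (e : CyclicEquiv Γ a a') : ∃ b', Deletes Γ a' b' ∧ CyclicEquiv Γ b b' := by
  induction e with
  | refl => exact ⟨b, h, .refl⟩
  | tail _ s ih =>
    obtain ⟨c, hc, e⟩ := ih
    rename_i w _
    have : ∃ b', Deletes Γ w b' ∧ CyclicEquiv Γ c b' := by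
      cases s with
      | swap l₁ l₂ y z hyz => exact deletes_swap hyz hc
      | rotate y l => exact deletes_rotate hc
    obtain ⟨d, hd, e'⟩ := this
    exact ⟨d, hd, e.trans e'⟩

/-- Deletion of a pair of inverse letters, on classes of cyclic words. -/
def Cancels (Γ : SimpleGraph V) (a b : Quot (CyclicStep Γ)) : Prop :=
  ∃ x u, a = Quot.mk _ (x :: letterInv x :: u) ∧ b = Quot.mk _ u

theorem quot_mk_eq_iff {a b : List (V × Bool)} :
    Quot.mk (CyclicStep Γ) a = Quot.mk _ b ↔ CyclicEquiv Γ a b := by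
  refine ⟨fun h => cyclicEquiv_of_eqvGen (Quot.eqvGen_exact h), fun h => ?_⟩
  induction h with
  | refl => rfl
  | tail _ s ih => exact ih.trans (Quot.sound s)

theorem Deletes.cancels {a b : List (V × Bool)} (h : Deletes Γ a b) :
    Cancels Γ (Quot.mk _ a) (Quot.mk _ b) := by
  obtain ⟨p, l, q, x, rfl, rfl, h⟩ := h
  rcases h with h | h
  · refine ⟨x, l ++ (q ++ p), ?_, ?_⟩ <;> rw [quot_mk_eq_iff]
    · refine (cyclicEquiv_rotate _ _).trans ?_
      have := cyclicEquiv_move (Γ := Γ) [x] l (q ++ p) (letterInv x) h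
      simpa using CyclicEquiv.symm this
    · simpa using cyclicEquiv_rotate (Γ := Γ) p (l ++ q)
  · refine ⟨letterInv x, q ++ (p ++ l), ?_, ?_⟩ <;> rw [quot_mk_eq_iff]
    · have h1 := cyclicEquiv_rotate (Γ := Γ) (p ++ x :: l) (letterInv x :: q)
      have h2 := cyclicEquiv_move (Γ := Γ) [letterInv x] (q ++ p) l x (fun y hy => h y (by
        simp only [List.mem_append] at hy ⊢; tauto))
      rw [letterInv_letterInv]
      refine Relation.ReflTransGen.trans (by simpa using h1) ?_
      simpa using CyclicEquiv.symm h2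
    · simpa using cyclicEquiv_rotate (Γ := Γ) (p ++ l) q

/-- Critical pair analysis. Deletions without a common letter can be carried out in either order. If
they share a letter, the surviving letters of the two results differ only by moving one letter along
a commuting arc. -/
theorem deletes_cons_cons {x : V × Bool} {u v : List (V × Bool)}
    (h : Deletes Γ (x :: letterInv x :: u) v) :
    CyclicEquiv Γ u v ∨ ∃ z, Deletes Γ u z ∧ Deletes Γ v z := by
  obtain ⟨p, a, q, y, h1, rfl, h3⟩ := h
  match p, h1 with
  | [], h1 =>
    simp only [List.nil_append, List.cons.injEq] at h1
    obtain ⟨rfl, h1⟩ := h1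
    match a, h1 with
    | [], h1 =>
      simp only [List.nil_append, List.cons.injEq, true_and] at h1
      subst h1
      exact Or.inl .refl
    | z :: a, h1 =>
      simp only [List.cons_append, List.cons.injEq] at h1
      obtain ⟨rfl, rfl⟩ := h1
      rcases h3 with h | h
      · exact absurd (h (letterInv x) (by simp)) Γ.irrefl
      · refine Or.inl (CyclicEquiv.symm ?_)
        refine (cyclicEquiv_rotate (Γ := Γ) [letterInv x] (a ++ q)).trans (CyclicEquiv.symm ?_)
        simpa using cyclicEquiv_move (Γ := Γ) a q [] (letterInv x) h
  | [w], h1 =>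
    simp only [List.cons_append, List.nil_append, List.cons.injEq] at h1
    obtain ⟨rfl, rfl, rfl⟩ := h1
    rw [letterInv_letterInv]
    rcases h3 with h | h
    · refine Or.inl (CyclicEquiv.symm ?_)
      simpa using cyclicEquiv_move (Γ := Γ) [] a q x h
    · exact absurd (h x (by simp)) Γ.irrefl
  | w :: w' :: p, h1 =>
    simp only [List.cons_append, List.cons.injEq] at h1
    obtain ⟨rfl, rfl, rfl⟩ := h1
    refine Or.inr ⟨p ++ (a ++ q), ⟨p, a, q, y, rfl, rfl, ?_⟩, [], [], p ++ (a ++ q), x, by simp,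
      by simp, Or.inl (by simp)⟩
    rcases h3 with h | h
    · exact Or.inl h
    · exact Or.inr fun z hz => h z (by simp at hz ⊢; tauto)

/-- At most one step is needed on each side, which is the form of local confluence under which
joinability is an equivalence relation without any termination argument. -/
theorem cancels_confluent (a b c : Quot (CyclicStep Γ)) (hb : Cancels Γ a b)
    (hc : Cancels Γ a c) :
    ∃ d, Relation.ReflGen (Cancels Γ) b d ∧ Relation.ReflTransGen (Cancels Γ) c d := by
  obtain ⟨x, u, rfl, rfl⟩ := hb
  obtain ⟨y, v, h, rfl⟩ := hc
  have hv : Deletes Γ (y :: letterInv y :: v) v :=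
    ⟨[], [], v, y, by simp, by simp, Or.inl (by simp)⟩
  -- The second cancellation is transported to the representative on which the first takes place at
  -- the front.
  obtain ⟨v', hv', e⟩ := deletes_cyclicEquiv hv (CyclicEquiv.symm (quot_mk_eq_iff.1 h))
  rw [quot_mk_eq_iff.2 e]
  rcases deletes_cons_cons hv' with e' | ⟨z, h1, h2⟩
  · rw [quot_mk_eq_iff.2 e']
    exact ⟨_, .refl, .refl⟩
  · exact ⟨_, .single h1.cancels, .single h2.cancels⟩

/-! ### Words representing the same element -/

/-- Words that differ by a swap of commuting letters or a free reduction. -/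
inductive WordStep (Γ : SimpleGraph V) : List (V × Bool) → List (V × Bool) → Prop
  | swap (l₁ l₂ : List (V × Bool)) (y z : V × Bool) (h : Γ.Adj y.1 z.1) :
      WordStep Γ (l₁ ++ y :: z :: l₂) (l₁ ++ z :: y :: l₂)
  | cancel (l₁ l₂ : List (V × Bool)) (x : V × Bool) :
      WordStep Γ (l₁ ++ x :: letterInv x :: l₂) (l₁ ++ l₂)

theorem WordStep.cons {a b : List (V × Bool)} (h : WordStep Γ a b) (x : V × Bool) :
    WordStep Γ (x :: a) (x :: b) := by
  cases h with
  | swap l₁ l₂ y z h => exact .swap (x :: l₁) l₂ y z h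
  | cancel l₁ l₂ y => exact .cancel (x :: l₁) l₂ y

/-- Left multiplication by a letter, on classes of words. -/
def consPerm (Γ : SimpleGraph V) (x : V × Bool) : Equiv.Perm (Quot (WordStep Γ)) where
  toFun := Quot.map (List.cons x) fun _ _ h => h.cons x
  invFun := Quot.map (List.cons (letterInv x)) fun _ _ h => h.cons _
  left_inv := by
    rintro ⟨l⟩
    refine Quot.sound ?_
    simpa [letterInv_letterInv] using WordStep.cancel (Γ := Γ) [] l (letterInv x)
  right_inv := by
    rintro ⟨l⟩
    exact Quot.sound (WordStep.cancel (Γ := Γ) [] l x)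

theorem consPerm_letterInv (x : V × Bool) : consPerm Γ (letterInv x) = (consPerm Γ x)⁻¹ := by
  ext ⟨l⟩
  rfl

/-- The action of `A_Γ` on classes of words. -/
def wordAction (Γ : SimpleGraph V) : RAAG Γ →* Equiv.Perm (Quot (WordStep Γ)) :=
  PresentedGroup.toGroup (f := fun v => consPerm Γ (v, true)) (by
    rintro _ ⟨v, w, h, rfl⟩
    rw [map_commutatorElement, FreeGroup.lift_apply_of, FreeGroup.lift_apply_of]
    refine commutatorElement_eq_one_iff_commute.2 (Equiv.ext ?_)
    rintro ⟨l⟩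
    exact Quot.sound (WordStep.swap [] l (v, true) (w, true) h))

theorem wordAction_letter (x : V × Bool) : wordAction Γ (letter Γ x) = consPerm Γ x := by
  have h : ∀ v, wordAction Γ (gen Γ v) = consPerm Γ (v, true) := fun v =>
    PresentedGroup.toGroup.of _
  obtain ⟨v, b⟩ := x
  cases b
  · simp only [letter, Bool.false_eq_true, if_false, map_inv, h]
    exact (consPerm_letterInv (v, true)).symm
  · simp [letter, h]

theorem wordAction_evalWord (w : List (V × Bool)) :
    wordAction Γ (evalWord Γ w) (Quot.mk _ []) = Quot.mk _ w := by
  induction w with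
  | nil => simp
  | cons x w ih =>
    rw [evalWord_cons, map_mul, Equiv.Perm.mul_apply, ih, wordAction_letter]
    rfl

/-- The group acts on classes of words by left multiplication, and an element applied to the empty
word returns the class of each word representing it. No normal form is needed. -/
theorem eqvGen_of_evalWord_eq {w w' : List (V × Bool)} (h : evalWord Γ w = evalWord Γ w') :
    Relation.EqvGen (WordStep Γ) w w' := by
  refine Quot.eqvGen_exact ?_
  rw [← wordAction_evalWord w, ← wordAction_evalWord w', h]

/-! ### Words representing conjugate elements -/

abbrev Joined (Γ : SimpleGraph V) (w w' : List (V × Bool)) : Prop :=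
  Relation.Join (Relation.ReflTransGen (Cancels Γ)) (Quot.mk _ w) (Quot.mk _ w')

theorem equivalence_join_cancels :
    Equivalence (Relation.Join (Relation.ReflTransGen (Cancels Γ))) :=
  Relation.equivalence_join_reflTransGen cancels_confluent

theorem Joined.of_cancels {w w' : List (V × Bool)}
    (h : Cancels Γ (Quot.mk _ w) (Quot.mk _ w')) : Joined Γ w w' :=
  ⟨_, .single h, .refl⟩

theorem joined_of_eqvGen {w w' : List (V × Bool)} (h : Relation.EqvGen (WordStep Γ) w w') :
    Joined Γ w w' := by
  induction h with
  | rel _ _ h =>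
    cases h with
    | swap l₁ l₂ y z h =>
      rw [Joined, Quot.sound (CyclicStep.swap l₁ l₂ y z h)]
      exact equivalence_join_cancels.refl _
    | cancel l₁ l₂ x =>
      exact .of_cancels (Deletes.cancels ⟨l₁, [], l₂, x, rfl, rfl, Or.inl (by simp)⟩)
  | refl => exact equivalence_join_cancels.refl _
  | symm _ _ _ ih => exact equivalence_join_cancels.symm ih
  | trans _ _ _ _ _ ih ih' => exact equivalence_join_cancels.trans ih ih'

theorem exists_evalWord (x : RAAG Γ) : ∃ w, evalWord Γ w = x := by
  have hinv : ∀ w : List (V × Bool), ∃ w', evalWord Γ w' = (evalWord Γ w)⁻¹ := by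
    intro w
    induction w with
    | nil => exact ⟨[], by simp⟩
    | cons x w ih =>
      obtain ⟨w', h⟩ := ih
      exact ⟨w' ++ [letterInv x], by simp [h, letter_letterInv]⟩
  induction x using PresentedGroup.induction_on with
  | _ z =>
    induction z using FreeGroup.induction_on with
    | C1 => exact ⟨[], by simp⟩
    | of v => exact ⟨[(v, true)], by simp [letter, gen, PresentedGroup.of]⟩
    | inv_of v _ => exact ⟨[(v, false)], by simp [letter, gen, PresentedGroup.of]⟩
    | mul a b ha hb =>
      obtain ⟨w, h⟩ := ha
      obtain ⟨w', h'⟩ := hb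
      exact ⟨w ++ w', by simp [h, h']⟩

theorem joined_conj (u w : List (V × Bool)) :
    Joined Γ w (u ++ w ++ (u.map letterInv).reverse) := by
  induction u generalizing w with
  | nil => simpa using equivalence_join_cancels.refl _
  | cons x u ih =>
    refine equivalence_join_cancels.trans (ih w) (equivalence_join_cancels.symm ?_)
    -- The two conjugating letters are neighbours on the circle: the outer arc is empty and its
    -- commutation condition vacuous.
    refine Joined.of_cancels (Deletes.cancels
      ⟨[], u ++ w ++ (u.map letterInv).reverse, [], x, by simp, by simp, Or.inr (by simp)⟩)

theorem evalWord_reverse_letterInv (u : List (V × Bool)) :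
    evalWord Γ (u.map letterInv).reverse = (evalWord Γ u)⁻¹ := by
  induction u with
  | nil => simp
  | cons x u ih => simp [ih, letter_letterInv]

theorem joined_of_mk_eq {w w' : List (V × Bool)}
    (h : ConjClasses.mk (evalWord Γ w) = ConjClasses.mk (evalWord Γ w')) : Joined Γ w w' := by
  rw [ConjClasses.mk_eq_mk_iff_isConj, isConj_iff] at h
  obtain ⟨c, hc⟩ := h
  obtain ⟨u, rfl⟩ := exists_evalWord c
  refine equivalence_join_cancels.trans (joined_conj u w) (joined_of_eqvGen
    (eqvGen_of_evalWord_eq ?_))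
  rw [← hc, evalWord_append, evalWord_append, evalWord_reverse_letterInv]

/-! ### Minimal words -/

/-- Functions on cyclic words that are invariant under swaps of commuting letters and do not
increase under free reduction. -/
structure CyclicMonotone (Γ : SimpleGraph V) (N : List (V × Bool) → ℕ) : Prop where
  swap : ∀ l₁ l₂ y z, Γ.Adj y.1 z.1 → N (l₁ ++ y :: z :: l₂) = N (l₁ ++ z :: y :: l₂)
  rotate : ∀ y l, N (y :: l) = N (l ++ [y])
  cancel : ∀ x l, N l ≤ N (x :: letterInv x :: l)

namespace CyclicMonotone

variable {N : List (V × Bool) → ℕ}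

theorem step (hN : CyclicMonotone Γ N) {a b : List (V × Bool)} (h : CyclicStep Γ a b) :
    N a = N b := by
  cases h with
  | swap l₁ l₂ y z h => exact hN.swap _ _ _ _ h
  | rotate y l => exact hN.rotate y l

theorem lift_le (hN : CyclicMonotone Γ N) {a b : Quot (CyclicStep Γ)}
    (h : Relation.ReflTransGen (Cancels Γ) a b) :
    Quot.lift N (fun _ _ => hN.step) b ≤ Quot.lift N (fun _ _ => hN.step) a := by
  induction h with
  | refl => exact le_rfl
  | tail _ h ih =>
    obtain ⟨x, u, rfl, rfl⟩ := h
    exact (hN.cancel x u).trans ih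

end CyclicMonotone

theorem mk_evalWord_cyclicEquiv {a b : List (V × Bool)} (h : CyclicEquiv Γ a b) :
    ConjClasses.mk (evalWord Γ a) = ConjClasses.mk (evalWord Γ b) := by
  induction h with
  | refl => rfl
  | tail _ h ih =>
    rw [ih]
    cases h with
    | swap l₁ l₂ y z h =>
      simp only [evalWord_append, evalWord_cons, ← mul_assoc]
      rw [mul_assoc (evalWord Γ l₁), (commute_letter_letter h).eq, ← mul_assoc]
    | rotate y l =>
      rw [ConjClasses.mk_eq_mk_iff_isConj, isConj_iff]
      exact ⟨(letter Γ y)⁻¹, by simp⟩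

theorem length_cyclicEquiv {a b : List (V × Bool)} (h : CyclicEquiv Γ a b) :
    a.length = b.length := by
  induction h with
  | refl => rfl
  | tail _ h ih =>
    rw [ih]
    cases h <;> simp

theorem classLength_le (w : List (V × Bool)) :
    classLength Γ (ConjClasses.mk (evalWord Γ w)) ≤ w.length :=
  Nat.sInf_le ⟨w, rfl, rfl⟩

theorem exists_classLength (c : ConjClasses (RAAG Γ)) :
    ∃ w : List (V × Bool), w.length = classLength Γ c ∧ ConjClasses.mk (evalWord Γ w) = c := by
  refine Nat.sInf_mem (s := {n | ∃ w : List (V × Bool), w.length = n ∧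
    ConjClasses.mk (evalWord Γ w) = c}) ?_
  induction c using Quotient.inductionOn with
  | _ x =>
    obtain ⟨w, rfl⟩ := exists_evalWord x
    exact ⟨_, w, rfl, rfl⟩

/-- A shortest word among those representing elements of a conjugacy class. -/
def minWord (Γ : SimpleGraph V) (c : ConjClasses (RAAG Γ)) : List (V × Bool) :=
  (exists_classLength c).choose

theorem length_minWord (c : ConjClasses (RAAG Γ)) : (minWord Γ c).length = classLength Γ c :=
  (exists_classLength c).choose_spec.1

theorem mk_minWord (c : ConjClasses (RAAG Γ)) :
    ConjClasses.mk (evalWord Γ (minWord Γ c)) = c :=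
  (exists_classLength c).choose_spec.2

/-- A shortest word of a conjugacy class minimizes all monotone functions simultaneously. -/
theorem CyclicMonotone.minWord_le {N : List (V × Bool) → ℕ} (hN : CyclicMonotone Γ N)
    {c : ConjClasses (RAAG Γ)} {w : List (V × Bool)} (h : ConjClasses.mk (evalWord Γ w) = c) :
    N (minWord Γ c) ≤ N w := by
  obtain ⟨d, h1, h2⟩ := joined_of_mk_eq ((mk_minWord c).trans h.symm)
  have hd : Quot.mk _ (minWord Γ c) = d := by
    rcases Relation.ReflTransGen.cases_head h1 with h | ⟨e, ⟨x, u, h, rfl⟩, -⟩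
    · exact h
    -- A cancellation would leave a word of the same class that is shorter by two letters.
    · exfalso
      rw [quot_mk_eq_iff] at h
      have e1 := length_cyclicEquiv h
      have e2 := mk_evalWord_cyclicEquiv h
      rw [mk_minWord, evalWord_cons, evalWord_cons, letter_letterInv, mul_inv_cancel_left] at e2
      have e3 := classLength_le (Γ := Γ) u
      rw [← e2, ← length_minWord, e1] at e3
      simp at e3
  subst hd
  exact hN.lift_le h2

end RAAG

end

noncomputable section

open scoped Classical

namespace RAAG

variable {V : Type u} {Γ : SimpleGraph V}

/-! ### Crossing numbers -/

/-- This closure property is the form in which the conditions on a pair are used from here on;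
`ofAdj` is the converse. -/
theorem DegenerateOrWhiteheadPair.mem_of_adj_of_not_adj (p : DegenerateOrWhiteheadPair Γ)
    {x : V × Bool} {w : V} (hx : x ∈ p.P) (h : Γ.Adj x.1 w) (hw : ¬ Γ.Adj w p.m.1) (c : Bool) :
    (w, c) ∈ p.P := by
  have hxm : ¬ Γ.Adj x.1 p.m.1 := p.not_adj x hx
  by_cases e : x.1 = p.m.1
  · exact absurd (e ▸ h.symm) hw
  · refine p.mem_of_adj h ?_ ?_ x.2 c hx
    · rintro (h' | h')
      · exact e h'
      · exact hxm h'.symm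
    · rintro (rfl | h')
      · exact hxm h
      · exact hw h'.symm

/-- The distance of two sides. -/
def sideDist (a b : Bool) : ℕ := if a = b then 0 else 1

@[simp] theorem sideDist_self (a : Bool) : sideDist a a = 0 := by simp [sideDist]

theorem sideDist_triangle (a b c : Bool) : sideDist a c ≤ sideDist a b + sideDist b c := by
  cases a <;> cases b <;> cases c <;> simp [sideDist]

/-- The number of times a path that reads the given word changes between `P` and its complement
outside of the letters; letters in the link of `v` stay on either side. -/
def crossings (Γ : SimpleGraph V) (P : Set (V × Bool)) (v : V) : Bool → List (V × Bool) → ℕ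
  | _, [] => 0
  | s, x :: l => if Γ.Adj x.1 v then crossings Γ P v s l else
      sideDist s (decide (letterInv x ∈ P)) + crossings Γ P v (decide (x ∈ P)) l

/-- The side on which such a path ends. -/
def finalSide (Γ : SimpleGraph V) (P : Set (V × Bool)) (v : V) : Bool → List (V × Bool) → Bool
  | s, [] => s
  | s, x :: l => if Γ.Adj x.1 v then finalSide Γ P v s l else finalSide Γ P v (decide (x ∈ P)) l

/-- The number of crossings of a cyclic word. -/
def cyclicCrossings (Γ : SimpleGraph V) (P : Set (V × Bool)) (v : V) (w : List (V × Bool)) : ℕ :=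
  crossings Γ P v (finalSide Γ P v false w) w

section Crossings

variable {P : Set (V × Bool)} {v : V}

theorem finalSide_append (s : Bool) (l l' : List (V × Bool)) :
    finalSide Γ P v s (l ++ l') = finalSide Γ P v (finalSide Γ P v s l) l' := by
  induction l generalizing s with
  | nil => rfl
  | cons x l ih =>
    simp only [List.cons_append, finalSide]
    split_ifs <;> exact ih _

theorem crossings_append (s : Bool) (l l' : List (V × Bool)) :
    crossings Γ P v s (l ++ l') =
      crossings Γ P v s l + crossings Γ P v (finalSide Γ P v s l) l' := by
  induction l generalizing s with
  | nil => simp [crossings, finalSide]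
  | cons x l ih =>
    simp only [List.cons_append, finalSide, crossings]
    split_ifs
    · exact ih _
    · rw [ih, add_assoc]

/-- Either some letter outside the link fixes the side, or all letters lie in the link and nothing
is ever crossed. Therefore the starting value `false` in `cyclicCrossings` is immaterial. -/
theorem finalSide_cases (w : List (V × Bool)) :
    (∀ s t, finalSide Γ P v s w = finalSide Γ P v t w) ∨
      ∀ t, finalSide Γ P v t w = t ∧ crossings Γ P v t w = 0 := by
  induction w with
  | nil => exact Or.inr fun t => ⟨rfl, rfl⟩
  | cons x l ih =>
    simp only [finalSide, crossings]
    split_ifs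
    · exact ih
    · exact Or.inl fun _ _ => rfl

theorem finalSide_finalSide (s : Bool) (w : List (V × Bool)) :
    finalSide Γ P v (finalSide Γ P v s w) w = finalSide Γ P v s w := by
  rcases finalSide_cases (Γ := Γ) (P := P) (v := v) w with h | h
  · exact h _ _
  · exact (h _).1

theorem cyclicCrossings_eq {s : Bool} {w : List (V × Bool)} (h : finalSide Γ P v s w = s) :
    cyclicCrossings Γ P v w = crossings Γ P v s w := by
  rcases finalSide_cases (Γ := Γ) (P := P) (v := v) w with h' | h'
  · rw [cyclicCrossings, h' false s, h]
  · rw [cyclicCrossings, (h' _).2, (h' _).2]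

theorem crossings_le (s t : Bool) (w : List (V × Bool)) :
    crossings Γ P v s w ≤ sideDist s t + crossings Γ P v t w := by
  induction w generalizing s t with
  | nil => simp [crossings]
  | cons x l ih =>
    simp only [crossings]
    split_ifs
    · exact ih _ _
    · have := sideDist_triangle s t (decide (letterInv x ∈ P))
      omega

end Crossings

/-- If neither of two adjacent vertices is in the link of the base, all four of their letters are on
the same side; a letter in the link does not affect the path at all. -/
theorem DegenerateOrWhiteheadPair.crossings_swap (p : DegenerateOrWhiteheadPair Γ)
    {y z : V × Bool} (h : Γ.Adj y.1 z.1) (s : Bool) (l : List (V × Bool)) :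
    crossings Γ p.P p.m.1 s (y :: z :: l) = crossings Γ p.P p.m.1 s (z :: y :: l) ∧
      finalSide Γ p.P p.m.1 s (y :: z :: l) = finalSide Γ p.P p.m.1 s (z :: y :: l) := by
  simp only [crossings, finalSide]
  by_cases hy : Γ.Adj y.1 p.m.1 <;> by_cases hz : Γ.Adj z.1 p.m.1 <;> simp only [hy, hz, if_true,
    if_false, and_self]
  have key : ∀ {y z : V × Bool}, Γ.Adj y.1 z.1 → ¬ Γ.Adj y.1 p.m.1 → ¬ Γ.Adj z.1 p.m.1 →
      y ∈ p.P → ∀ c d, (y.1, c) ∈ p.P ∧ (z.1, d) ∈ p.P := fun h hy hz hyP c d =>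
    ⟨p.mem_of_adj_of_not_adj (p.mem_of_adj_of_not_adj hyP h hz true) h.symm hy c,
      p.mem_of_adj_of_not_adj hyP h hz d⟩
  have all : ∃ b : Bool, ∀ c d, decide ((y.1, c) ∈ p.P) = b ∧ decide ((z.1, d) ∈ p.P) = b := by
    by_cases hP : ∃ c, (y.1, c) ∈ p.P ∨ (z.1, c) ∈ p.P
    · refine ⟨true, fun c d => ?_⟩
      obtain ⟨c', h1 | h1⟩ := hP
      · simpa using key (y := (y.1, c')) h hy hz h1 c d
      · simpa [and_comm] using key (y := (z.1, c')) h.symm hz hy h1 d c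
    · push Not at hP
      exact ⟨false, fun c d => by simp [hP]⟩
  obtain ⟨b, hb⟩ := all
  have e1 := (hb y.2 z.2).1
  have e2 := (hb y.2 z.2).2
  have e3 : decide (letterInv y ∈ p.P) = b := (hb (!y.2) (!z.2)).1
  have e4 : decide (letterInv z ∈ p.P) = b := (hb (!y.2) (!z.2)).2
  simp only [Prod.eta] at e1 e2
  simp only [e1, e2, e3, e4, and_self]

/-- Cancellation is the triangle inequality: an inserted pair `x x⁻¹` outside the link only forces
the path to visit the side of `x⁻¹`. -/
theorem DegenerateOrWhiteheadPair.cyclicMonotone_cyclicCrossings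
    (p : DegenerateOrWhiteheadPair Γ) :
    CyclicMonotone Γ (cyclicCrossings Γ p.P p.m.1) where
  swap l₁ l₂ y z h := by
    have h1 : ∀ s, finalSide Γ p.P p.m.1 s (l₁ ++ y :: z :: l₂) =
        finalSide Γ p.P p.m.1 s (l₁ ++ z :: y :: l₂) := fun s => by
      rw [finalSide_append, finalSide_append, (p.crossings_swap h _ _).2]
    rw [cyclicCrossings, cyclicCrossings, h1, crossings_append, crossings_append,
      (p.crossings_swap h _ _).1]
  rotate y l := by
    by_cases hy : Γ.Adj y.1 p.m.1
    · simp [cyclicCrossings, finalSide_append, crossings_append, finalSide, crossings, hy]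
    · have h1 : finalSide Γ p.P p.m.1 (decide (y ∈ p.P)) (l ++ [y]) = decide (y ∈ p.P) := by
        simp [finalSide_append, finalSide, hy]
      rw [cyclicCrossings_eq h1, crossings_append]
      simp [cyclicCrossings, finalSide, crossings, hy, add_comm]
  cancel x l := by
    have hx' : (letterInv x).1 = x.1 := rfl
    by_cases hx : Γ.Adj x.1 p.m.1
    · simp [cyclicCrossings, finalSide, crossings, hx, hx']
    · rcases finalSide_cases (Γ := Γ) (P := p.P) (v := p.m.1) l with h | h
      · rw [cyclicCrossings, cyclicCrossings]
        simp only [finalSide, crossings, hx', hx, if_false, letterInv_letterInv, sideDist_self,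
          zero_add]
        rw [h false (decide (letterInv x ∈ p.P))]
        exact crossings_le _ _ _
      · rw [cyclicCrossings, (h _).2]
        exact Nat.zero_le _

theorem cyclicMonotone_countP (v : V) :
    CyclicMonotone Γ (List.countP fun x : V × Bool => decide (x.1 = v)) where
  swap l₁ l₂ y z _ := by
    simp only [List.countP_append, List.countP_cons]
    ring
  rotate y l := by simp [List.countP_append, List.countP_cons]
  cancel x l := by
    simp only [List.countP_cons]
    omega

/-! ### Images of words under Whitehead automorphisms -/

namespace DegenerateOrWhiteheadPair

variable (p : DegenerateOrWhiteheadPair Γ)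

/-- The contribution of a side to the images of letters. -/
def sideElt (s : Bool) : RAAG Γ := if s = true then letter Γ p.m else 1

theorem fst_eq_iff {x m : V × Bool} : x.1 = m.1 ↔ x = m ∨ x = letterInv m := by
  obtain ⟨v, b⟩ := x
  obtain ⟨w, c⟩ := m
  cases b <;> cases c <;> simp [letterInv]

/-- Uniform shape of the automorphism: corrections at the two ends of a letter depend only on their
sides, and a base letter consists of its corrections alone. Between consecutive letters the
corrections then combine. -/
theorem hom_letter (x : V × Bool) : p.hom (letter Γ x) =
    p.sideElt (decide (letterInv x ∈ p.P)) * (if x.1 = p.m.1 then 1 else letter Γ x) *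
      (p.sideElt (decide (x ∈ p.P)))⁻¹ := by
  by_cases hx : x.1 = p.m.1
  · rcases fst_eq_iff.1 hx with rfl | rfl
    · simp [sideElt, p.m_mem, p.letterInv_m_notMem, hom_letter_m]
    · have : (letterInv p.m).1 = p.m.1 := rfl
      simp [sideElt, p.m_mem, p.letterInv_m_notMem, letterInv_letterInv, letter_letterInv,
        hom_letter_m, this]
  · obtain ⟨v, b⟩ := x
    simp only at hx
    cases b
    · simp only [letter, Bool.false_eq_true, if_false, map_inv, hom_gen,
        whiteheadImage_of_ne _ _ _ hx, letterInv, hx, Bool.not_false, sideElt, decide_eq_true_eq]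
      split_ifs <;> simp [mul_assoc]
    · simp only [letter, if_true, hom_gen, whiteheadImage_of_ne _ _ _ hx, letterInv, hx,
        if_false, Bool.not_true, sideElt, decide_eq_true_eq]
      split_ifs <;> simp [mul_assoc]

/-- The word obtained by applying a Whitehead automorphism to every letter. -/
def imageBlock (x : V × Bool) : List (V × Bool) :=
  if x.1 = p.m.1 then [letterInv x] else
    (if letterInv x ∈ p.P then [p.m] else []) ++ x :: (if x ∈ p.P then [letterInv p.m] else [])

theorem evalWord_imageBlock (x : V × Bool) :
    evalWord Γ (p.imageBlock x) = p.hom (letter Γ x) := by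
  by_cases hx : x.1 = p.m.1
  · rw [imageBlock, if_pos hx]
    rcases fst_eq_iff.1 hx with rfl | rfl
    · simp [hom_letter_m, letter_letterInv]
    · simp [hom_letter_m, letter_letterInv]
  · rw [hom_letter, imageBlock, if_neg hx, if_neg hx]
    simp only [sideElt, decide_eq_true_eq]
    split_ifs <;> simp [letter_letterInv, mul_assoc]

theorem evalWord_flatMap_imageBlock (w : List (V × Bool)) :
    evalWord Γ (w.flatMap p.imageBlock) = p.hom (evalWord Γ w) := by
  induction w with
  | nil => simp
  | cons x w ih => simp [ih, evalWord_imageBlock]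

theorem countP_imageBlock {v : V} (hv : v ≠ p.m.1) (x : V × Bool) :
    (p.imageBlock x).countP (fun y => decide (y.1 = v)) = if x.1 = v then 1 else 0 := by
  unfold imageBlock
  have h1 : (letterInv x).1 = x.1 := rfl
  have h2 : (letterInv p.m).1 = p.m.1 := rfl
  by_cases hx : x.1 = p.m.1
  · simp [hx, h1, hv.symm]
  · rw [if_neg hx]
    split_ifs <;> simp_all [hv.symm]

theorem countP_flatMap_imageBlock {v : V} (hv : v ≠ p.m.1) (w : List (V × Bool)) :
    (w.flatMap p.imageBlock).countP (fun y => decide (y.1 = v)) =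
      w.countP (fun y => decide (y.1 = v)) := by
  induction w with
  | nil => rfl
  | cons x w ih =>
    rw [List.flatMap_cons, List.countP_append, ih, p.countP_imageBlock hv, List.countP_cons]
    simp [add_comm]

/-- Amortised estimate, with the distance to the outer side as potential. The image of a letter
other than the base leads back outside at no extra cost, because the inserted letters perform the
changes of side; a base letter costs at most one. -/
theorem crossings_imageBlock (s : Bool) (x : V × Bool) :
    crossings Γ p.P p.m.1 s (p.imageBlock x) +
      sideDist (finalSide Γ p.P p.m.1 s (p.imageBlock x)) false ≤
      sideDist s false + if x.1 = p.m.1 then 1 else 0 := by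
  have h1 : (letterInv x).1 = x.1 := rfl
  have h2 : (letterInv p.m).1 = p.m.1 := rfl
  have h3 := p.m_mem
  have h4 := p.letterInv_m_notMem
  by_cases hx : x.1 = p.m.1
  · rw [imageBlock, if_pos hx]
    rcases fst_eq_iff.1 hx with rfl | rfl
    · cases s <;> simp [crossings, finalSide, h2, h3, h4, letterInv_letterInv, sideDist]
    · cases s <;> simp [crossings, finalSide, h2, h3, h4, letterInv_letterInv, sideDist]
  · rw [imageBlock, if_neg hx]
    by_cases hl : Γ.Adj x.1 p.m.1
    · have h5 : x ∉ p.P := fun h => p.not_adj x h hl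
      have h6 : letterInv x ∉ p.P := fun h => p.not_adj _ h hl
      simp [h5, h6, crossings, finalSide, hl, hx]
    · by_cases h5 : x ∈ p.P <;> by_cases h6 : letterInv x ∈ p.P <;>
        simp [h5, h6, crossings, finalSide, hl, hx, h2, h3, h4, letterInv_letterInv]

theorem crossings_flatMap_imageBlock (s : Bool) (w : List (V × Bool)) :
    crossings Γ p.P p.m.1 s (w.flatMap p.imageBlock) +
      sideDist (finalSide Γ p.P p.m.1 s (w.flatMap p.imageBlock)) false ≤
      sideDist s false + w.countP (fun y => decide (y.1 = p.m.1)) := by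
  induction w generalizing s with
  | nil => simp [crossings, finalSide]
  | cons x w ih =>
    have h1 := p.crossings_imageBlock s x
    have h2 := ih (finalSide Γ p.P p.m.1 s (p.imageBlock x))
    rw [List.flatMap_cons, crossings_append, finalSide_append, List.countP_cons]
    simp only [decide_eq_true_eq]
    omega

/-- A closed path has the same potential at both ends, so the potentials cancel. -/
theorem cyclicCrossings_flatMap_imageBlock (w : List (V × Bool)) :
    cyclicCrossings Γ p.P p.m.1 (w.flatMap p.imageBlock) ≤
      w.countP (fun y => decide (y.1 = p.m.1)) := by
  have h := p.crossings_flatMap_imageBlock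
    (finalSide Γ p.P p.m.1 false (w.flatMap p.imageBlock)) w
  rw [finalSide_finalSide] at h
  unfold cyclicCrossings
  omega

/-- The word that has to be inserted when the side changes. -/
def gapWord : Bool → Bool → List (V × Bool)
  | false, true => [p.m]
  | true, false => [letterInv p.m]
  | _, _ => []

/-- The image of a word under a Whitehead automorphism, with letters inserted only at crossings. -/
def tightImage : Bool → List (V × Bool) → List (V × Bool)
  | _, [] => []
  | s, x :: l => if Γ.Adj x.1 p.m.1 then x :: tightImage s l else
      p.gapWord s (decide (letterInv x ∈ p.P)) ++
        ((if x.1 = p.m.1 then [] else [x]) ++ tightImage (decide (x ∈ p.P)) l)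

theorem evalWord_gapWord (s t : Bool) :
    evalWord Γ (p.gapWord s t) = (p.sideElt s)⁻¹ * p.sideElt t := by
  cases s <;> cases t <;> simp [gapWord, sideElt, letter_letterInv]

/-- The corrections telescope: a gap from `s` to `t` contributes the inverse of the first correction
times the second. Link letters commute with the corrections, so a pending one passes through them.
-/
theorem evalWord_tightImage (s : Bool) (w : List (V × Bool)) :
    evalWord Γ (p.tightImage s w) =
      (p.sideElt s)⁻¹ * p.hom (evalWord Γ w) * p.sideElt (finalSide Γ p.P p.m.1 s w) := by
  induction w generalizing s with
  | nil => simp [tightImage, finalSide]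
  | cons x w ih =>
    simp only [tightImage, finalSide]
    by_cases hx : Γ.Adj x.1 p.m.1
    · have h5 : x ∉ p.P := fun h => p.not_adj x h hx
      have h6 : letterInv x ∉ p.P := fun h => p.not_adj _ h hx
      have hc : Commute (letter Γ x) (p.sideElt s)⁻¹ := by
        unfold sideElt
        split_ifs
        · exact (commute_letter_letter hx).inv_right
        · simp
      have h7 : p.hom (letter Γ x) = letter Γ x := by
        rw [hom_letter]
        simp [h5, h6, sideElt, hx.ne]
      rw [if_pos hx, if_pos hx, evalWord_cons, evalWord_cons, ih, map_mul, h7]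
      simp only [← mul_assoc]
      rw [hc.eq]
    · rw [if_neg hx, if_neg hx, evalWord_append, evalWord_append, ih, evalWord_gapWord,
        evalWord_cons, map_mul, hom_letter]
      split_ifs <;> simp [mul_assoc]

theorem countP_tightImage_self (s : Bool) (w : List (V × Bool)) :
    (p.tightImage s w).countP (fun y => decide (y.1 = p.m.1)) = crossings Γ p.P p.m.1 s w := by
  have hg : ∀ s t, (p.gapWord s t).countP (fun y => decide (y.1 = p.m.1)) = sideDist s t := by
    have h2 : (letterInv p.m).1 = p.m.1 := rfl
    intro s t
    cases s <;> cases t <;> simp [gapWord, h2, sideDist]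
  induction w generalizing s with
  | nil => rfl
  | cons x w ih =>
    simp only [tightImage, crossings]
    by_cases hx : Γ.Adj x.1 p.m.1
    · simp [hx, ih, hx.ne]
    · by_cases hx' : x.1 = p.m.1
      · simp [hx', List.countP_append, ih, hg]
      · simp [hx, hx', List.countP_append, ih, hg]

end DegenerateOrWhiteheadPair

/-! ### Change of length under Whitehead automorphisms -/

/-- The number of letters `v` or `v⁻¹` in a shortest word of a conjugacy class. -/
def classCount (Γ : SimpleGraph V) (v : V) (c : ConjClasses (RAAG Γ)) : ℕ :=
  (minWord Γ c).countP fun x => decide (x.1 = v)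

/-- The number of crossings of a shortest word of a conjugacy class. -/
def classCrossings (Γ : SimpleGraph V) (P : Set (V × Bool)) (v : V) (c : ConjClasses (RAAG Γ)) :
    ℕ :=
  cyclicCrossings Γ P v (minWord Γ c)

theorem sum_classCount [Fintype V] (c : ConjClasses (RAAG Γ)) :
    ∑ v, classCount Γ v c = classLength Γ c := by
  rw [← length_minWord]
  unfold classCount
  induction minWord Γ c with
  | nil => simp
  | cons x l ih => simp [List.countP_cons, Finset.sum_add_distrib, ih]

namespace DegenerateOrWhiteheadPair

variable (p : DegenerateOrWhiteheadPair Γ)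

/-- The outer automorphism of a pair. -/
def out : Out (RAAG Γ) := toOut (RAAG Γ) p.aut

theorem aut_mul_self : p.aut * p.aut = 1 := by
  ext x
  exact DFunLike.congr_fun p.hom_hom x

theorem out_mul_self : p.out * p.out = 1 := by
  rw [out, ← map_mul, aut_mul_self, map_one]

theorem out_inv : p.out⁻¹ = p.out := inv_eq_of_mul_eq_one_left p.out_mul_self

theorem outAct_out_out (c : ConjClasses (RAAG Γ)) : outAct p.out (outAct p.out c) = c := by
  rw [← outAct_mul, out_mul_self, outAct_one]

theorem mk_flatMap_imageBlock (w : List (V × Bool)) :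
    ConjClasses.mk (evalWord Γ (w.flatMap p.imageBlock)) =
      outAct p.out (ConjClasses.mk (evalWord Γ w)) := by
  rw [evalWord_flatMap_imageBlock]
  rfl

theorem mk_tightImage (w : List (V × Bool)) :
    ConjClasses.mk (evalWord Γ (p.tightImage (finalSide Γ p.P p.m.1 false w) w)) =
      outAct p.out (ConjClasses.mk (evalWord Γ w)) := by
  rw [evalWord_tightImage, finalSide_finalSide]
  change _ = ConjClasses.mk (p.hom (evalWord Γ w))
  rw [ConjClasses.mk_eq_mk_iff_isConj, isConj_iff]
  exact ⟨p.sideElt (finalSide Γ p.P p.m.1 false w), by simp [mul_assoc]⟩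

/-- Only base letters are inserted, which gives one inequality; the automorphism is an involution,
which gives the other. -/
theorem classCount_outAct_of_ne {v : V} (hv : v ≠ p.m.1) (c : ConjClasses (RAAG Γ)) :
    classCount Γ v (outAct p.out c) = classCount Γ v c := by
  have h : ∀ c, classCount Γ v (outAct p.out c) ≤ classCount Γ v c := by
    intro c
    have := (cyclicMonotone_countP v).minWord_le (p.mk_flatMap_imageBlock (minWord Γ c))
    rwa [p.countP_flatMap_imageBlock hv, mk_minWord] at this
  refine le_antisymm (h c) ?_
  have := h (outAct p.out c)
  rwa [outAct_out_out] at this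

/-- The tight image of a shortest word of `c` bounds the count from above. Mapping a shortest word
of the image class back to `c` bounds the crossings of `c` by the count. -/
theorem classCount_outAct_self (c : ConjClasses (RAAG Γ)) :
    classCount Γ p.m.1 (outAct p.out c) = classCrossings Γ p.P p.m.1 c := by
  refine le_antisymm ?_ ?_
  · have := (cyclicMonotone_countP p.m.1).minWord_le (p.mk_tightImage (minWord Γ c))
    rwa [countP_tightImage_self, mk_minWord] at this
  · have := p.cyclicMonotone_cyclicCrossings.minWord_le
      (p.mk_flatMap_imageBlock (minWord Γ (outAct p.out c)))
    rw [mk_minWord, outAct_out_out] at this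
    exact this.trans (p.cyclicCrossings_flatMap_imageBlock _)

theorem classLength_outAct_add [Finite V] (c : ConjClasses (RAAG Γ)) :
    classLength Γ (outAct p.out c) + classCount Γ p.m.1 c =
      classLength Γ c + classCount Γ p.m.1 (outAct p.out c) := by
  let _ := Fintype.ofFinite V
  rw [← sum_classCount, ← sum_classCount, ← Finset.add_sum_erase _ _ (Finset.mem_univ p.m.1),
    ← Finset.add_sum_erase _ (fun v => classCount Γ v c) (Finset.mem_univ p.m.1),
    Finset.sum_congr rfl fun v hv => p.classCount_outAct_of_ne (Finset.ne_of_mem_erase hv) c]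
  ring

end DegenerateOrWhiteheadPair

end RAAG

end

noncomputable section

open scoped Classical

namespace RAAG

variable {V : Type u} {Γ : SimpleGraph V}

/-! ### Operations on Whitehead pairs: complements, corners, differences, rebasing -/

theorem aut_ext_letter {φ ψ : MulAut (RAAG Γ)}
    (h : ∀ x : V × Bool, φ (letter Γ x) = ψ (letter Γ x)) : φ = ψ :=
  aut_ext fun v => by simpa [letter] using h (v, true)

theorem aut_ext_of_letters {φ ψ : MulAut (RAAG Γ)} (y z : V × Bool)
    (hy : φ (letter Γ y) = ψ (letter Γ y)) (hz : φ (letter Γ z) = ψ (letter Γ z))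
    (h : ∀ x : V × Bool, x.1 ≠ y.1 → x.1 ≠ z.1 → φ (letter Γ x) = ψ (letter Γ x)) : φ = ψ := by
  have key : ∀ {x y : V × Bool}, x.1 = y.1 → φ (letter Γ y) = ψ (letter Γ y) →
      φ (letter Γ x) = ψ (letter Γ x) := by
    intro x y hxy hy
    rcases DegenerateOrWhiteheadPair.fst_eq_iff.1 hxy with rfl | rfl
    · exact hy
    · rw [letter_letterInv, map_inv, map_inv, hy]
  refine aut_ext_letter fun x => ?_
  by_cases hx : x.1 = y.1
  · exact key hx hy
  · by_cases hx' : x.1 = z.1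
    · exact key hx' hz
    · exact h x hx hx'

theorem toOut_conj (g : RAAG Γ) : toOut (RAAG Γ) (MulAut.conj g) = 1 :=
  (QuotientGroup.eq_one_iff _).2 ⟨g, rfl⟩

namespace DegenerateOrWhiteheadPair

theorem aut_apply (p : DegenerateOrWhiteheadPair Γ) (x : RAAG Γ) : p.aut x = p.hom x := rfl

/-- A criterion for Whitehead pairs: up to the link of `m`, the set `P` is closed under passing
to adjacent vertices. -/
def ofAdj (P : Set (V × Bool)) (m : V × Bool) (hm : m ∈ P) (hm' : letterInv m ∉ P)
    (hadj : ∀ x ∈ P, ¬ Γ.Adj x.1 m.1)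
    (h : ∀ x ∈ P, ∀ w, Γ.Adj x.1 w → ¬ Γ.Adj w m.1 → ∀ c, (w, c) ∈ P) :
    DegenerateOrWhiteheadPair Γ where
  P := P
  m := m
  m_mem := hm
  letterInv_m_notMem := hm'
  not_adj := hadj
  single_le := by
    intro x hx hx' w hw
    -- A neighbour of `x` outside the star of `m` would lie in `P`, and adjacency would then bring
    -- `x⁻¹` back into `P`.
    by_contra hc
    have hwm : ¬ Γ.Adj w m.1 := fun h' => hc (Or.inr h'.symm)
    have h1 := h x hx w hw hwm true
    exact hx' (h _ h1 x.1 (SimpleGraph.Adj.symm hw) (hadj x hx) _)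
  double_mem := by
    rintro v h1 h2 w ⟨hv, hw, ⟨r⟩⟩
    have key : ∀ (a b : ((vertexStar Γ m.1)ᶜ : Set V)),
        (Γ.induce (vertexStar Γ m.1)ᶜ).Walk a b →
        ((a : V), true) ∈ P ∧ ((a : V), false) ∈ P → ((b : V), true) ∈ P ∧ ((b : V), false) ∈ P := by
      intro a b r
      induction r with
      | nil => exact id
      | @cons a b c hab _ ih =>
        intro ha
        have hab' : Γ.Adj (a : V) b := hab
        have hb : ¬ Γ.Adj (b : V) m.1 := fun h' => b.2 (Or.inr h'.symm)
        exact ih ⟨h _ ha.1 _ hab' hb _, h _ ha.1 _ hab' hb _⟩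
    exact key _ _ r ⟨h1, h2⟩

/-- The other side of a Whitehead pair. -/
def compl (p : DegenerateOrWhiteheadPair Γ) : DegenerateOrWhiteheadPair Γ :=
  ofAdj {x | x ∉ p.P ∧ ¬ Γ.Adj x.1 p.m.1} (letterInv p.m)
    ⟨p.letterInv_m_notMem, Γ.irrefl⟩
    (fun h => h.1 (by rw [letterInv_letterInv]; exact p.m_mem))
    (fun _ hx => hx.2)
    (fun x hx w hw hwm c => ⟨fun h => hx.1 (by
      simpa using p.mem_of_adj_of_not_adj h hw.symm hx.2 x.2), hwm⟩)

@[simp] theorem compl_m (p : DegenerateOrWhiteheadPair Γ) : p.compl.m = letterInv p.m := rfl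

theorem mem_compl (p : DegenerateOrWhiteheadPair Γ) {x : V × Bool} :
    x ∈ p.compl.P ↔ x ∉ p.P ∧ ¬ Γ.Adj x.1 p.m.1 := Iff.rfl

/-- The automorphisms differ by conjugation with the base letter; the link letters left out of the
complement commute with it. -/
theorem out_compl (p : DegenerateOrWhiteheadPair Γ) : p.compl.out = p.out := by
  have : p.compl.aut = MulAut.conj (letter Γ p.m)⁻¹ * p.aut := by
    refine aut_ext_letter fun x => ?_
    rw [MulAut.mul_apply, MulAut.conj_apply, aut_apply, aut_apply, hom_letter, hom_letter,
      inv_inv]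
    have h1 : (letterInv x).1 = x.1 := rfl
    have h2 : p.compl.m.1 = p.m.1 := rfl
    have h3 : letter Γ p.compl.m = (letter Γ p.m)⁻¹ := letter_letterInv _
    by_cases hx : Γ.Adj x.1 p.m.1
    · have h5 : x ∉ p.P := fun h => p.not_adj x h hx
      have h6 : letterInv x ∉ p.P := fun h => p.not_adj _ h hx
      have hc : Commute (letter Γ x) (letter Γ p.m) := commute_letter_letter hx
      simp [mem_compl, h1, h2, hx, h5, h6, sideElt, hx.ne, mul_assoc, hc.eq, -compl_m]
    · by_cases hxm : x.1 = p.m.1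
      · rcases fst_eq_iff.1 hxm with rfl | rfl
        · simp [mem_compl, h1, p.m_mem, p.letterInv_m_notMem, sideElt, letter_letterInv]
        · simp [mem_compl, p.m_mem, p.letterInv_m_notMem, sideElt, letter_letterInv,
            letterInv_letterInv, hxm]
      · by_cases h5 : x ∈ p.P <;> by_cases h6 : letterInv x ∈ p.P <;>
          simp [mem_compl, h1, h2, h3, hx, h5, h6, sideElt, hxm, mul_assoc, -compl_m]
  rw [out, this, map_mul, toOut_conj, one_mul, out]

/-- The corner `P ∩ Q` with the base of `P`. -/
def corner (p q : DegenerateOrWhiteheadPair Γ) (hp : p.m ∈ q.P) (hq : letterInv q.m ∉ p.P)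
    (hpq : ¬ Γ.Adj p.m.1 q.m.1) : DegenerateOrWhiteheadPair Γ :=
  ofAdj (p.P ∩ q.P) p.m ⟨p.m_mem, hp⟩ (fun h => p.letterInv_m_notMem h.1)
    (fun x hx => p.not_adj x hx.1)
    (fun x hx y hy hym c => by
      have hyP := p.mem_of_adj_of_not_adj hx.1 hy hym
      -- If `y` were in the link of the base of `Q`, adjacency would propagate from `y ∈ P` to both
      -- letters of that base, contrary to `hq`.
      by_cases hyq : Γ.Adj y q.m.1
      · exact absurd (p.mem_of_adj_of_not_adj (hyP true) hyq (fun h => hpq h.symm) _) hq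
      · exact ⟨hyP c, q.mem_of_adj_of_not_adj hx.2 hy hyq c⟩)

/-- The pair `(Q ∖ P ∪ {m}, m)` for nested pairs `P ⊆ Q` with the same base `m`. -/
def diff (p q : DegenerateOrWhiteheadPair Γ) (hpq : p.m = q.m) :
    DegenerateOrWhiteheadPair Γ :=
  ofAdj {x | x = q.m ∨ x ∈ q.P ∧ x ∉ p.P} q.m (Or.inl rfl)
    (fun h' => h'.elim (letterInv_ne _) fun h' => q.letterInv_m_notMem h'.1)
    (by
      rintro x (rfl | hx)
      · exact Γ.irrefl
      · exact q.not_adj x hx.1)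
    (by
      rintro x (rfl | hx) w hw hwm c
      · exact absurd hw.symm hwm
      · refine Or.inr ⟨q.mem_of_adj_of_not_adj hx.1 hw hwm c, fun hc => hx.2 ?_⟩
        have := p.mem_of_adj_of_not_adj hc hw.symm (by rw [hpq]; exact q.not_adj x hx.1) x.2
        simpa using this)

theorem aut_diff (p q : DegenerateOrWhiteheadPair Γ) (hpq : p.m = q.m) (h : p.P ⊆ q.P) :
    q.aut = p.aut * (inv Γ q.m).aut * (p.diff q hpq).aut := by
  refine q.aut_factor p (p.diff q hpq) hpq rfl (fun x hx => ?_) fun x hx hx' h' => ?_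
  · constructor
    · intro hxq
      by_cases hxp : x ∈ p.P
      · exact Or.inl hxp
      · exact Or.inr (Or.inr ⟨hxq, hxp⟩)
    · rintro (h' | h' | h')
      · exact h h'
      · exact absurd h' hx
      · exact h'.1
  · rcases h' with h' | h'
    · exact hx h'
    · exact h'.2 hx'

/-- The same set with another base with the same link. -/
def rebase (p : DegenerateOrWhiteheadPair Γ) (w : V × Bool) (hw : w ∈ p.P)
    (hw' : letterInv w ∉ p.P) (hl : ∀ y, Γ.Adj y p.m.1 ↔ Γ.Adj y w.1) :
    DegenerateOrWhiteheadPair Γ :=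
  ofAdj p.P w hw hw' (fun x hx => by rw [← hl]; exact p.not_adj x hx)
    (fun x hx y hy hyw c => p.mem_of_adj_of_not_adj hx hy (by rwa [hl]) c)

end DegenerateOrWhiteheadPair

/-! ### Graph automorphisms and exchange of letters with equal links -/

/-- The endomorphism of `A_Γ` induced by an automorphism of `Γ`. -/
def graphHom (π : Γ ≃g Γ) : RAAG Γ →* RAAG Γ :=
  PresentedGroup.toGroup (f := fun v => gen Γ (π v)) (by
    rintro _ ⟨v, w, h, rfl⟩
    rw [map_commutatorElement, FreeGroup.lift_apply_of, FreeGroup.lift_apply_of]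
    exact commutatorElement_eq_one_iff_commute.2 (commute_gen (π.map_adj_iff.2 h)))

theorem graphHom_gen (π : Γ ≃g Γ) (v : V) : graphHom π (gen Γ v) = gen Γ (π v) :=
  PresentedGroup.toGroup.of _

/-- The automorphism of `A_Γ` induced by an automorphism of `Γ`. -/
def graphAut (π : Γ ≃g Γ) : MulAut (RAAG Γ) :=
  MonoidHom.toMulEquiv (graphHom π) (graphHom π.symm)
    (PresentedGroup.ext fun v => by
      change graphHom π.symm (graphHom π (gen Γ v)) = gen Γ v
      simp [graphHom_gen])
    (PresentedGroup.ext fun v => by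
      change graphHom π (graphHom π.symm (gen Γ v)) = gen Γ v
      simp [graphHom_gen])

theorem graphAut_gen (π : Γ ≃g Γ) (v : V) : graphAut π (gen Γ v) = gen Γ (π v) :=
  graphHom_gen π v

/-- The automorphism of `Γ` that interchanges two vertices with the same link. -/
def swapIso (v w : V) (h : ∀ y, Γ.Adj y v ↔ Γ.Adj y w) : Γ ≃g Γ where
  toEquiv := Equiv.swap v w
  map_rel_iff' := by
    have h1 : ∀ a b, Γ.Adj (Equiv.swap v w a) b ↔ Γ.Adj a b := by
      intro a b
      by_cases hv : a = v
      · subst hv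
        rw [Equiv.swap_apply_left, Γ.adj_comm, ← h, Γ.adj_comm]
      · by_cases hw : a = w
        · subst hw
          rw [Equiv.swap_apply_right, Γ.adj_comm, h, Γ.adj_comm]
        · rw [Equiv.swap_apply_of_ne_of_ne hv hw]
    intro a b
    rw [h1, Γ.adj_comm, h1, Γ.adj_comm]

/-- There is an automorphism induced by an isomorphism of the Salvetti complex that interchanges
two given letters with the same link. -/
theorem exists_swap_letters (x y : V × Bool) (hxy : x.1 ≠ y.1)
    (h : ∀ z, Γ.Adj z x.1 ↔ Γ.Adj z y.1) :
    ∃ φ : MulAut (RAAG Γ), toOut (RAAG Γ) φ ∈ salvettiIso Γ ∧ φ (letter Γ x) = letter Γ y ∧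
      φ (letter Γ y) = letter Γ x ∧ ∀ u, u ≠ x.1 → u ≠ y.1 → φ (gen Γ u) = gen Γ u := by
  obtain ⟨v, b⟩ := x
  obtain ⟨w, c⟩ := y
  simp only at h hxy
  have hπ : toOut (RAAG Γ) (graphAut (swapIso v w h)) ∈ salvettiIso Γ :=
    Subgroup.subset_closure ⟨_, Or.inl ⟨_, graphAut_gen _⟩, rfl⟩
  have hI : ∀ z, toOut (RAAG Γ) (DegenerateOrWhiteheadPair.inv Γ z).aut ∈ salvettiIso Γ :=
    fun z => Subgroup.subset_closure
      ⟨_, Or.inr (DegenerateOrWhiteheadPair.isInversion_inv z), rfl⟩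
  have e1 : swapIso v w h v = w := Equiv.swap_apply_left v w
  have e2 : swapIso v w h w = v := Equiv.swap_apply_right v w
  have e3 : ∀ u, u ≠ v → u ≠ w → swapIso v w h u = u := fun u h1 h2 =>
    Equiv.swap_apply_of_ne_of_ne h1 h2
  have i1 := DegenerateOrWhiteheadPair.inv_aut_self (Γ := Γ) (v, true)
  have i2 := DegenerateOrWhiteheadPair.inv_aut_self (Γ := Γ) (w, true)
  have i3 := fun u => DegenerateOrWhiteheadPair.inv_aut_of_ne (Γ := Γ) (v, true) (u := u)
  have i4 := fun u => DegenerateOrWhiteheadPair.inv_aut_of_ne (Γ := Γ) (w, true) (u := u)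
  simp only at i1 i2 i3 i4
  by_cases hbc : b = c
  · refine ⟨graphAut (swapIso v w h), hπ, ?_, ?_, fun u h1 h2 => ?_⟩
    · cases b <;> simp [letter, graphAut_gen, e1, ← hbc]
    · cases b <;> simp [letter, graphAut_gen, e2, ← hbc]
    · rw [graphAut_gen, e3 u h1 h2]
  -- For opposite signs the transposition sends each letter to the inverse of the other; inverting
  -- both generators corrects this.
  · refine ⟨graphAut (swapIso v w h) * ((DegenerateOrWhiteheadPair.inv Γ (v, true)).aut *
      (DegenerateOrWhiteheadPair.inv Γ (w, true)).aut), ?_, ?_, ?_, fun u h1 h2 => ?_⟩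
    · rw [map_mul, map_mul]
      exact mul_mem hπ (mul_mem (hI _) (hI _))
    · cases b <;> cases c <;> simp_all [letter, graphAut_gen, MulAut.mul_apply]
    · cases b <;> cases c <;>
        simp_all [letter, graphAut_gen, MulAut.mul_apply, i3 w (Ne.symm hxy)]
    · simp only [MulAut.mul_apply, i4 u h2, i3 u h1]
      rw [graphAut_gen, e3 u h1 h2]

/-! ### Relations between Whitehead automorphisms -/

namespace DegenerateOrWhiteheadPair

theorem hom_letter_of_notMem (p : DegenerateOrWhiteheadPair Γ) {x : V × Bool} (h : x.1 ≠ p.m.1)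
    (h1 : x ∉ p.P) (h2 : letterInv x ∉ p.P) : p.hom (letter Γ x) = letter Γ x := by
  rw [hom_letter]
  simp [h, h1, h2, sideElt]

/-- The factor `h` exchanges the two bases. Since it does not change a marked Salvetti, the results
of a move and of its rebased version differ by a single move. -/
theorem out_mul_out_rebase (p : DegenerateOrWhiteheadPair Γ) (w : V × Bool) (hw : w ∈ p.P)
    (hw' : letterInv w ∉ p.P) (hl : ∀ y, Γ.Adj y p.m.1 ↔ Γ.Adj y w.1) (hne : p.m.1 ≠ w.1) :
    ∃ h ∈ salvettiIso Γ, p.out * (p.rebase w hw hw' hl).out = (p.rebase w hw hw' hl).out * h := by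
  obtain ⟨φ, hφ, h1, h2, h3⟩ := exists_swap_letters p.m w hne hl
  refine ⟨_, hφ, ?_⟩
  rw [out, out, ← map_mul, ← map_mul]
  congr 1
  have hP : (p.rebase w hw hw' hl).P = p.P := rfl
  have hm : (p.rebase w hw hw' hl).m = w := rfl
  have hs : (p.rebase w hw hw' hl).sideElt true = letter Γ w := by simp [sideElt, hm]
  have hs' : (p.rebase w hw hw' hl).sideElt false = 1 := by simp [sideElt]
  have ht : p.sideElt true = letter Γ p.m := by simp [sideElt]
  have ht' : p.sideElt false = 1 := by simp [sideElt]
  refine aut_ext_of_letters p.m w ?_ ?_ fun x hx1 hx2 => ?_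
  · simp only [MulAut.mul_apply, aut_apply, h1]
    simp [hom_letter, hP, hm, hw, hw', hne, hne.symm, p.m_mem, p.letterInv_m_notMem, hs, hs', ht,
      ht']
  · simp only [MulAut.mul_apply, aut_apply, h2]
    simp [hom_letter, hP, hm, hw, hw', hne, hne.symm, p.m_mem, p.letterInv_m_notMem, hs, hs', ht,
      ht']
  · have : φ (letter Γ x) = letter Γ x := by
      unfold letter
      split_ifs <;> simp [h3 _ hx1 hx2]
    simp only [MulAut.mul_apply, aut_apply, this]
    rw [hom_letter _ x, hm, hP, if_neg hx2]
    by_cases h5 : x ∈ p.P <;> by_cases h6 : letterInv x ∈ p.P <;>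
      simp [hom_letter, hw, hw', hne.symm, hs, hs', ht, ht', h5, h6, hx1, mul_assoc]

/-- Pairs that are adjacent, or disjoint with bases that do not interfere, commute. -/
theorem out_commute (p q : DegenerateOrWhiteheadPair Γ) (hne : p.m.1 ≠ q.m.1)
    (h1 : p.m ∉ q.P) (h2 : letterInv p.m ∉ q.P) (h3 : q.m ∉ p.P) (h4 : letterInv q.m ∉ p.P)
    (h : Γ.Adj p.m.1 q.m.1 ∨ Disjoint p.P q.P) : p.out * q.out = q.out * p.out := by
  rw [out, out, ← map_mul, ← map_mul]
  congr 1
  have e1 := q.hom_letter_of_notMem hne h1 h2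
  have e2 := p.hom_letter_of_notMem hne.symm h3 h4
  have e3 := p.hom_letter_m
  have e4 := q.hom_letter_m
  have hm : (p.aut * q.aut) (letter Γ p.m) = (q.aut * p.aut) (letter Γ p.m) := by
    simp [MulAut.mul_apply, aut_apply, e1, e3]
  have hm' : (p.aut * q.aut) (letter Γ q.m) = (q.aut * p.aut) (letter Γ q.m) := by
    simp [MulAut.mul_apply, aut_apply, e2, e4]
  refine aut_ext_of_letters p.m q.m hm hm' fun x hx1 hx2 => ?_
  have hp : p.hom (letter Γ x) = _ := p.hom_letter x
  have hq : q.hom (letter Γ x) = _ := q.hom_letter x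
  rw [if_neg hx1] at hp
  rw [if_neg hx2] at hq
  have hs1 : ∀ b, q.hom (p.sideElt b) = p.sideElt b := by
    intro b
    cases b <;> simp [sideElt, e1]
  have hs2 : ∀ b, p.hom (q.sideElt b) = q.sideElt b := by
    intro b
    cases b <;> simp [sideElt, e2]
  simp only [MulAut.mul_apply, aut_apply, hp, hq, map_mul, map_inv, hs1, hs2]
  have hc : ∀ y : V × Bool, Commute (p.sideElt (decide (y ∈ p.P)))
      (q.sideElt (decide (y ∈ q.P))) := by
    intro y
    unfold sideElt
    split_ifs with a b
    · rcases h with h | h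
      · exact commute_letter_letter h
      · exact absurd (of_decide_eq_true b) (Set.disjoint_left.1 h (of_decide_eq_true a))
    all_goals simp
  have c1 := hc (letterInv x)
  have c2 := hc x
  rw [← mul_assoc, ← mul_assoc, ← mul_assoc, ← mul_assoc, c1.eq, mul_assoc _ _ (_)⁻¹,
    mul_assoc _ _ (_)⁻¹, ← mul_inv_rev, ← mul_inv_rev, c2.eq]

/-- For disjoint pairs with `w⁻¹ ∈ P` and `v⁻¹ ∉ Q`, the pair `P ∪ Q ∖ {w⁻¹}` with base `v`. -/
def union (p q : DegenerateOrWhiteheadPair Γ) (hadj : ¬ Γ.Adj p.m.1 q.m.1)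
    (hne : p.m.1 ≠ q.m.1) (hd : Disjoint p.P q.P)
    (h1 : letterInv q.m ∈ p.P) (h2 : letterInv p.m ∉ q.P) : DegenerateOrWhiteheadPair Γ :=
  have hw : q.m ∉ p.P := fun h => Set.disjoint_left.1 hd h q.m_mem
  -- The base of `Q` is split by `P`, so its link lies in the link of the base of `P`.
  have hle : ∀ y, Γ.Adj y q.m.1 → Γ.Adj y p.m.1 := fun y hy => by
    by_contra hc
    have h3 := p.mem_of_adj_of_not_adj h1 (w := y) hy.symm hc true
    exact hw (p.mem_of_adj_of_not_adj h3 hy (fun h => hadj h.symm) q.m.2)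
  ofAdj {x | x ≠ letterInv q.m ∧ (x ∈ p.P ∨ x ∈ q.P)} p.m
    ⟨fun h => hne (congrArg Prod.fst h :), Or.inl p.m_mem⟩
    (fun h => h.2.elim p.letterInv_m_notMem h2)
    (by
      rintro x ⟨-, hx | hx⟩ hxp
      · exact p.not_adj x hx hxp
      · exact Set.disjoint_left.1 hd p.m_mem (q.mem_of_adj_of_not_adj hx hxp hadj _))
    (by
      rintro x ⟨-, hx | hx⟩ y hy hyp c
      · have hyP := p.mem_of_adj_of_not_adj hx hy hyp
        refine ⟨fun h => hw ?_, Or.inl (hyP c)⟩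
        have := hyP q.m.2
        rwa [show y = q.m.1 from congrArg Prod.fst h] at this
      · have hyQ := q.mem_of_adj_of_not_adj hx hy (fun h => hyp (hle y h)) c
        exact ⟨fun h => Set.disjoint_left.1 hd h1 (h ▸ hyQ), Or.inr hyQ⟩)

/-- The automorphism of `Q` inverts `w`, which turns multiplication by `v` at the end `w⁻¹` into
multiplication at the end `w`. This is why the union contains `w` in place of `w⁻¹`. -/
theorem out_union (p q : DegenerateOrWhiteheadPair Γ) (hadj : ¬ Γ.Adj p.m.1 q.m.1)
    (hne : p.m.1 ≠ q.m.1) (hd : Disjoint p.P q.P)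
    (h1 : letterInv q.m ∈ p.P) (h2 : letterInv p.m ∉ q.P) :
    p.out * q.out = q.out * (p.union q hadj hne hd h1 h2).out := by
  rw [out, out, out, ← map_mul, ← map_mul]
  congr 1
  have hr : ∀ x, x ∈ (p.union q hadj hne hd h1 h2).P ↔
      x ≠ letterInv q.m ∧ (x ∈ p.P ∨ x ∈ q.P) := fun x => Iff.rfl
  have hrm : (p.union q hadj hne hd h1 h2).m = p.m := rfl
  generalize p.union q hadj hne hd h1 h2 = r at hr hrm
  have hd' : ∀ x, x ∈ p.P → x ∉ q.P := fun x hx => Set.disjoint_left.1 hd hx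
  have h3 : p.m ∉ q.P := hd' _ p.m_mem
  have h4 : q.m ∉ p.P := fun h => hd' _ h q.m_mem
  have e1 := q.hom_letter_of_notMem hne h3 h2
  have e3 := p.hom_letter_m
  have e4 := q.hom_letter_m
  have hs : p.sideElt true = letter Γ p.m := by simp [sideElt]
  have hs' : p.sideElt false = 1 := by simp [sideElt]
  have ht : q.sideElt true = letter Γ q.m := by simp [sideElt]
  have ht' : q.sideElt false = 1 := by simp [sideElt]
  have hu : r.sideElt true = letter Γ p.m := by simp [sideElt, hrm]
  have hu' : r.sideElt false = 1 := by simp [sideElt]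
  have e5 : p.hom (letter Γ q.m) = letter Γ p.m * letter Γ q.m := by
    rw [hom_letter]
    simp [h1, h4, hne.symm, hs, hs']
  have hm : (p.aut * q.aut) (letter Γ p.m) = (q.aut * r.aut) (letter Γ p.m) := by
    have := r.hom_letter_m
    rw [hrm] at this
    simp [MulAut.mul_apply, aut_apply, e1, e3, this]
  have hm' : (p.aut * q.aut) (letter Γ q.m) = (q.aut * r.aut) (letter Γ q.m) := by
    have : r.hom (letter Γ q.m) = letter Γ q.m * (letter Γ p.m)⁻¹ := by
      rw [hom_letter]
      simp [hr, hrm, hne.symm, q.m_mem, (letterInv_ne q.m).symm, hu, hu']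
    simp [MulAut.mul_apply, aut_apply, this, e4, e5, e1]
  refine aut_ext_of_letters p.m q.m hm hm' fun x hx1 hx2 => ?_
  have r1 : x ∈ r.P ↔ x ∈ p.P ∨ x ∈ q.P :=
    (hr x).trans (and_iff_right fun h => hx2 (congrArg Prod.fst h :))
  have r2 : letterInv x ∈ r.P ↔ letterInv x ∈ p.P ∨ letterInv x ∈ q.P :=
    (hr _).trans (and_iff_right fun h => hx2 (congrArg Prod.fst h :))
  simp only [MulAut.mul_apply, aut_apply]
  rw [q.hom_letter x, r.hom_letter x, hrm, if_neg hx1, if_neg hx2]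
  have a1 := hd' x
  have a2 := hd' (letterInv x)
  by_cases b1 : x ∈ p.P <;> by_cases b2 : x ∈ q.P <;> by_cases b3 : letterInv x ∈ p.P <;>
    by_cases b4 : letterInv x ∈ q.P <;>
    simp [b1, b2] at a1 <;> simp [b3, b4] at a2 <;>
    simp [p.hom_letter x, q.hom_letter x, r1, r2, b1, b2, b3, b4, hs, hs', ht, ht', hu, hu', hx1,
      hx2, e1, e5, mul_assoc]

/-! ### Transport along isomorphisms of the Salvetti complex -/

/-- The image of a pair under a permutation of the letters. -/
def map (p : DegenerateOrWhiteheadPair Γ) (f : Equiv.Perm (V × Bool))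
    (hinv : ∀ x, f (letterInv x) = letterInv (f x))
    (hadj : ∀ x y, Γ.Adj (f x).1 (f y).1 ↔ Γ.Adj x.1 y.1) : DegenerateOrWhiteheadPair Γ :=
  ofAdj (f '' p.P) (f p.m) ⟨_, p.m_mem, rfl⟩
    (by
      rw [← hinv, f.injective.mem_set_image]
      exact p.letterInv_m_notMem)
    (by
      rintro _ ⟨x, hx, rfl⟩
      rw [hadj]
      exact p.not_adj x hx)
    (by
      rintro _ ⟨x, hx, rfl⟩ w hw hwm c
      obtain ⟨y, hy⟩ := f.surjective (w, c)
      have e : w = (f y).1 := by rw [hy]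
      rw [e, hadj] at hw hwm
      rw [← hy]
      exact ⟨y, p.mem_of_adj_of_not_adj hx hw hwm y.2, rfl⟩)

theorem out_map (p : DegenerateOrWhiteheadPair Γ) (f : Equiv.Perm (V × Bool))
    (hinv : ∀ x, f (letterInv x) = letterInv (f x))
    (hadj : ∀ x y, Γ.Adj (f x).1 (f y).1 ↔ Γ.Adj x.1 y.1) (φ : MulAut (RAAG Γ))
    (hφ : ∀ x, φ (letter Γ x) = letter Γ (f x)) :
    toOut (RAAG Γ) φ * p.out = (p.map f hinv hadj).out * toOut (RAAG Γ) φ := by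
  rw [out, out, ← map_mul, ← map_mul]
  congr 1
  refine aut_ext_letter fun x => ?_
  have hs : ∀ b, φ (p.sideElt b) = (p.map f hinv hadj).sideElt b := by
    intro b
    cases b
    · simp [sideElt]
    · simp [sideElt, hφ, map, ofAdj]
  have hm : ∀ x, f x ∈ (p.map f hinv hadj).P ↔ x ∈ p.P := fun x =>
    f.injective.mem_set_image
  have h1 : (f x).1 = (p.map f hinv hadj).m.1 ↔ x.1 = p.m.1 := by
    change (f x).1 = (f p.m).1 ↔ _
    rw [fst_eq_iff, fst_eq_iff, ← hinv, f.injective.eq_iff, f.injective.eq_iff]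
  simp only [MulAut.mul_apply, aut_apply, hφ]
  rw [hom_letter, hom_letter, ← hinv]
  simp only [map_mul, map_inv, hs, hm, h1]
  split_ifs <;> simp [hφ]

/-- Both conjugates are treated together so that the induction over the generated subgroup passes to
inverses. -/
theorem exists_conj_out {h : Out (RAAG Γ)} (hh : h ∈ salvettiIso Γ) :
    ∀ p : DegenerateOrWhiteheadPair Γ, (∃ q : DegenerateOrWhiteheadPair Γ,
      h * p.out * h⁻¹ = q.out) ∧ ∃ q : DegenerateOrWhiteheadPair Γ, h⁻¹ * p.out * h = q.out := by
  unfold salvettiIso at hh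
  induction hh using Subgroup.closure_induction with
  | mem h hh =>
    have key : ∀ (f : Equiv.Perm (V × Bool)) (φ : MulAut (RAAG Γ)),
        (∀ x, f (letterInv x) = letterInv (f x)) →
        (∀ x y, Γ.Adj (f x).1 (f y).1 ↔ Γ.Adj x.1 y.1) →
        (∀ x, φ (letter Γ x) = letter Γ (f x)) → ∀ p : DegenerateOrWhiteheadPair Γ,
        (∃ q : DegenerateOrWhiteheadPair Γ,
          toOut (RAAG Γ) φ * p.out * (toOut (RAAG Γ) φ)⁻¹ = q.out) ∧
        ∃ q : DegenerateOrWhiteheadPair Γ,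
          (toOut (RAAG Γ) φ)⁻¹ * p.out * toOut (RAAG Γ) φ = q.out := by
      intro f φ hinv hadj hφ p
      have hinv' : ∀ x, f.symm (letterInv x) = letterInv (f.symm x) := fun x => by
        rw [Equiv.symm_apply_eq, hinv, Equiv.apply_symm_apply]
      have hadj' : ∀ x y, Γ.Adj (f.symm x).1 (f.symm y).1 ↔ Γ.Adj x.1 y.1 := fun x y => by
        rw [← hadj, Equiv.apply_symm_apply, Equiv.apply_symm_apply]
      have hφ' : ∀ x, φ⁻¹ (letter Γ x) = letter Γ (f.symm x) := fun x => by
        have := hφ (f.symm x)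
        rw [Equiv.apply_symm_apply] at this
        rw [← this]
        simp
      refine ⟨⟨_, by rw [p.out_map f hinv hadj φ hφ, mul_inv_cancel_right]⟩,
        p.map f.symm hinv' hadj', ?_⟩
      have := p.out_map f.symm hinv' hadj' φ⁻¹ hφ'
      rw [map_inv] at this
      rw [this, inv_mul_cancel_right]
    obtain ⟨φ, hφ | hφ, rfl⟩ := hh
    · obtain ⟨π, hπ⟩ := hφ
      refine key (Equiv.prodCongr π.toEquiv (Equiv.refl Bool)) φ (fun x => rfl) (fun x y => ?_) ?_
      · exact π.map_adj_iff
      · rintro ⟨v, b⟩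
        cases b <;> simp [letter, hπ]
    · obtain ⟨v, h1, h2⟩ := hφ
      have hf : Function.Involutive
          (fun x : V × Bool => if x.1 = v then (x.1, !x.2) else x) := by
        rintro ⟨u, b⟩
        by_cases hu : u = v <;> simp [hu]
      have e1 : ∀ x : V × Bool, x.1 = v → Function.Involutive.toPerm _ hf x = (x.1, !x.2) :=
        fun x hx => if_pos hx
      have e2 : ∀ x : V × Bool, x.1 ≠ v → Function.Involutive.toPerm _ hf x = x :=
        fun x hx => if_neg hx
      have e3 : ∀ x : V × Bool, (Function.Involutive.toPerm _ hf x).1 = x.1 := fun x => by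
        by_cases hx : x.1 = v
        · rw [e1 x hx]
        · rw [e2 x hx]
      refine key (Function.Involutive.toPerm _ hf) φ (fun x => ?_) (fun x y => ?_) ?_
      · by_cases hx : x.1 = v
        · rw [e1 x hx, e1 (letterInv x) hx]
          rfl
        · rw [e2 x hx, e2 (letterInv x) hx]
      · rw [e3, e3]
      · rintro ⟨u, b⟩
        by_cases hu : u = v
        · rw [e1 _ hu]
          subst hu
          cases b <;> simp [letter, h1]
        · rw [e2 _ hu]
          cases b <;> simp [letter, h2 u hu]
  | one => exact fun p => ⟨⟨p, by simp⟩, p, by simp⟩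
  | mul α β _ _ h1 h2 =>
    intro p
    obtain ⟨q, hq⟩ := (h2 p).1
    obtain ⟨q', hq'⟩ := (h1 q).1
    obtain ⟨r, hr⟩ := (h1 p).2
    obtain ⟨r', hr'⟩ := (h2 r).2
    refine ⟨⟨q', ?_⟩, r', ?_⟩
    · rw [← hq', ← hq]
      group
    · rw [← hr', ← hr]
      group
  | inv α _ h =>
    intro p
    rw [inv_inv]
    exact ⟨(h p).2, (h p).1⟩

end DegenerateOrWhiteheadPair

end RAAG

end

noncomputable section

open scoped Classical

namespace RAAG

variable {V : Type u} {Γ : SimpleGraph V}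

/-! ### Crossing numbers of corners -/

theorem crossings_congr {P : Set (V × Bool)} {v w : V} (h : ∀ y, Γ.Adj y v ↔ Γ.Adj y w)
    (s : Bool) (l : List (V × Bool)) :
    crossings Γ P v s l = crossings Γ P w s l ∧ finalSide Γ P v s l = finalSide Γ P w s l := by
  induction l generalizing s with
  | nil => exact ⟨rfl, rfl⟩
  | cons x l ih =>
    simp only [crossings, finalSide, h]
    split_ifs
    · exact ih s
    · exact ⟨by rw [(ih _).1], (ih _).2⟩

theorem classCrossings_congr {P : Set (V × Bool)} {v w : V} (h : ∀ y, Γ.Adj y v ↔ Γ.Adj y w)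
    (c : ConjClasses (RAAG Γ)) : classCrossings Γ P v c = classCrossings Γ P w c := by
  rw [classCrossings, classCrossings, cyclicCrossings, cyclicCrossings,
    (crossings_congr h _ _).1, (crossings_congr h _ _).2]

/-- Submodularity for one step: when the sides change from `(a, b)` to `(a', b')`, the two opposite
corners are together entered and left at most as often as the two sets. The sides `s`, `t` may lag
behind the corner sides. -/
theorem sideDist_corner (a b a' b' s t : Bool) :
    sideDist s (a' && b') + sideDist t (!a' && !b') ≤
      sideDist s (a && b) + sideDist t (!a && !b) + sideDist a a' + sideDist b b' := by
  revert a b a' b' s t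
  decide

namespace DegenerateOrWhiteheadPair

/-- The corner opposite to `p.corner q`. -/
abbrev oppositeCorner (p q : DegenerateOrWhiteheadPair Γ) (hp : p.m ∈ q.P)
    (hq : letterInv q.m ∉ p.P) (hpq : ¬ Γ.Adj p.m.1 q.m.1) : DegenerateOrWhiteheadPair Γ :=
  q.compl.corner p.compl ⟨hq, fun h => hpq h.symm⟩
    (fun h => h.1 (by rw [compl_m, letterInv_letterInv]; exact hp)) (fun h => hpq h.symm)

/-- The corners' paths need not be where `a` and `b` predict, since the link of either base is
ignored by only one of them. The distances to the predicted sides serve as a potential in the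
induction. -/
theorem crossings_corner_add_le (p q : DegenerateOrWhiteheadPair Γ) (hp : p.m ∈ q.P)
    (hq : letterInv q.m ∉ p.P) (hpq : ¬ Γ.Adj p.m.1 q.m.1) (w : List (V × Bool))
    (a b s t : Bool) :
    crossings Γ (p.P ∩ q.P) p.m.1 s w + crossings Γ (q.compl.P ∩ p.compl.P) q.m.1 t w +
      sideDist (finalSide Γ (p.P ∩ q.P) p.m.1 s w)
        (finalSide Γ p.P p.m.1 a w && finalSide Γ q.P q.m.1 b w) +
      sideDist (finalSide Γ (q.compl.P ∩ p.compl.P) q.m.1 t w)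
        (!finalSide Γ p.P p.m.1 a w && !finalSide Γ q.P q.m.1 b w) ≤
    sideDist s (a && b) + sideDist t (!a && !b) +
      crossings Γ p.P p.m.1 a w + crossings Γ q.P q.m.1 b w := by
  induction w generalizing a b s t with
  | nil => simp [crossings, finalSide, add_comm]
  | cons x w ih =>
    have hx : (letterInv x).1 = x.1 := rfl
    simp only [crossings, finalSide]
    by_cases h1 : Γ.Adj x.1 p.m.1 <;> by_cases h2 : Γ.Adj x.1 q.m.1
    · simp only [h1, h2, if_true]
      exact ih a b s t
    -- The letter commutes with the base of `P`, which lies in `Q`, so both its signs lie in `Q`.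
    -- The side for `P` and the corner path `s` stay; the side for `Q` becomes `true`, and the
    -- opposite corner is left.
    · have h3 : ∀ c, (x.1, c) ∈ q.P := q.mem_of_adj_of_not_adj hp h1.symm h2
      have h4 : x ∈ q.P := h3 x.2
      have h5 : letterInv x ∈ q.P := h3 _
      have h := ih a true s false
      have h' := sideDist_corner a b a true s t
      simp only [h1, h2, h4, h5, if_true, if_false, mem_compl, Set.mem_inter_iff, not_true,
        false_and, decide_true, decide_false] at h ⊢
      simp only [Bool.not_true, Bool.and_false, sideDist_self] at h h'
      omega
    -- Dually, the letter commutes with the base of `Q`, and neither of its signs lies in `P`, as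
    -- otherwise `Q`'s inverse base would too.
    · have h3 : ∀ c, (x.1, c) ∉ p.P := fun c h3 =>
        hq (p.mem_of_adj_of_not_adj h3 h2 (fun h => hpq h.symm) _)
      have h4 : x ∉ p.P := h3 x.2
      have h5 : letterInv x ∉ p.P := h3 _
      have h := ih false b false t
      have h' := sideDist_corner a b false b s t
      simp only [h1, h2, h4, h5, if_true, if_false, Set.mem_inter_iff,
        false_and, decide_false] at h ⊢
      simp only [Bool.false_and, sideDist_self] at h h'
      omega
    · have h := ih (decide (x ∈ p.P)) (decide (x ∈ q.P)) (decide (x ∈ p.P) && decide (x ∈ q.P))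
        (!decide (x ∈ p.P) && !decide (x ∈ q.P))
      have h' := sideDist_corner a b (decide (letterInv x ∈ p.P)) (decide (letterInv x ∈ q.P)) s t
      have e1 : ∀ (y : V × Bool) [Decidable (y ∈ p.P ∩ q.P)], decide (y ∈ p.P ∩ q.P) =
          (decide (y ∈ p.P) && decide (y ∈ q.P)) :=
        fun y _ => by simp [Set.mem_inter_iff]
      have e2 : ∀ [Decidable (x ∈ q.compl.P ∩ p.compl.P)],
          decide (x ∈ q.compl.P ∩ p.compl.P) = (!decide (x ∈ p.P) && !decide (x ∈ q.P)) := by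
        simp [Set.mem_inter_iff, mem_compl, h1, h2, Bool.and_comm]
      have e3 : ∀ [Decidable (letterInv x ∈ q.compl.P ∩ p.compl.P)],
          decide (letterInv x ∈ q.compl.P ∩ p.compl.P) =
            (!decide (letterInv x ∈ p.P) && !decide (letterInv x ∈ q.P)) := by
        simp [Set.mem_inter_iff, mem_compl, hx, h1, h2, Bool.and_comm]
      simp only [h1, h2, if_false, e1, e2, e3]
      simp only [sideDist_self] at h
      omega

/-- All four paths are started on their own final sides; they close up, and the potential terms
cancel. -/
theorem classCrossings_corner_add_le (p q : DegenerateOrWhiteheadPair Γ) (hp : p.m ∈ q.P)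
    (hq : letterInv q.m ∉ p.P) (hpq : ¬ Γ.Adj p.m.1 q.m.1) (c : ConjClasses (RAAG Γ)) :
    classCrossings Γ (p.corner q hp hq hpq).P p.m.1 c +
        classCrossings Γ (p.oppositeCorner q hp hq hpq).P q.m.1 c ≤
      classCrossings Γ p.P p.m.1 c + classCrossings Γ q.P q.m.1 c := by
  have h := p.crossings_corner_add_le q hp hq hpq (minWord Γ c)
    (finalSide Γ p.P p.m.1 false (minWord Γ c)) (finalSide Γ q.P q.m.1 false (minWord Γ c))
    (finalSide Γ (p.P ∩ q.P) p.m.1 false (minWord Γ c))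
    (finalSide Γ (q.compl.P ∩ p.compl.P) q.m.1 false (minWord Γ c))
  simp only [finalSide_finalSide] at h
  change cyclicCrossings Γ (p.P ∩ q.P) p.m.1 _ +
    cyclicCrossings Γ (q.compl.P ∩ p.compl.P) q.m.1 _ ≤ _
  unfold classCrossings cyclicCrossings
  omega

/-- The star in the order relation improves to the link, because no element of `P` is adjacent to
the base. -/
theorem adj_base_of_split (p : DegenerateOrWhiteheadPair Γ) {x : V × Bool} (hx : x ∈ p.P)
    (hx' : letterInv x ∉ p.P) {y : V} (hy : Γ.Adj y x.1) : Γ.Adj y p.m.1 := by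
  rcases p.single_le x hx hx' hy.symm with h | h
  · exact absurd (h ▸ hy.symm) (p.not_adj x hx)
  · exact h.symm

/-- The element of `Out_ℓ(A_Γ)` given by a possibly degenerate pair. -/
def outL [Finite V] (p : DegenerateOrWhiteheadPair Γ) : OutL Γ :=
  ⟨p.out, by
    rw [OutL, ← MonoidHom.map_closure]
    exact Subgroup.mem_map_of_mem _ p.aut_mem⟩

end DegenerateOrWhiteheadPair

/-! ### Norms -/

namespace MarkedSalvetti

theorem mk_mul_of_mem (α : OutL Γ) {h : OutL Γ} (hh : (h : Out (RAAG Γ)) ∈ salvettiIso Γ) :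
    mk (α * h) = mk α :=
  (QuotientGroup.mk_mul_of_mem α (Subgroup.mem_subgroupOf.2 hh))

variable [Finite V] (g : ℕ → ConjClasses (RAAG Γ))

/-- The value of the norm at `α` with the length replaced by another function. -/
def weight (α : OutL Γ) (f : ConjClasses (RAAG Γ) → ℕ) : ℤ ×ₗ Lex (ℕ → ℤ) :=
  toLex (∑ c ∈ (shortClasses_finite Γ).toFinset, (f (outAct (α : Out (RAAG Γ))⁻¹ c) : ℤ),
    toLex fun i => (f (outAct (α : Out (RAAG Γ))⁻¹ (g i)) : ℤ))

variable {g}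

theorem weight_add (α : OutL Γ) (f f' : ConjClasses (RAAG Γ) → ℕ) :
    weight g α (fun c => f c + f' c) = weight g α f + weight g α f' := by
  unfold weight
  simp only [Nat.cast_add, Finset.sum_add_distrib]
  rfl

theorem weight_mono (α : OutL Γ) {f f' : ConjClasses (RAAG Γ) → ℕ} (h : ∀ c, f c ≤ f' c) :
    weight g α f ≤ weight g α f' := by
  refine Prod.Lex.toLex_mono (Prod.mk_le_mk.2 ⟨?_, Pi.toLex_monotone fun i => ?_⟩)
  · exact Finset.sum_le_sum fun c _ => Nat.cast_le.2 (h _)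
  · exact Nat.cast_le.2 (h _)

theorem norm_mk (α : OutL Γ) : (mk α).norm g = weight g α (classLength Γ) := rfl

theorem norm_mk_mul (α β : OutL Γ) : (mk (α * β)).norm g =
    weight g α fun c => classLength Γ (outAct (β : Out (RAAG Γ))⁻¹ c) := by
  have h : ∀ c, outAct ((α * β : OutL Γ) : Out (RAAG Γ))⁻¹ c =
      outAct (β : Out (RAAG Γ))⁻¹ (outAct (α : Out (RAAG Γ))⁻¹ c) := fun c => by
    rw [← outAct_mul, Subgroup.coe_mul, mul_inv_rev]
  rw [norm_mk]
  unfold weight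
  simp only [h]

theorem norm_mk_mul_outL (α : OutL Γ) (p : DegenerateOrWhiteheadPair Γ) :
    (mk (α * p.outL)).norm g = weight g α fun c => classLength Γ (outAct p.out c) := by
  rw [norm_mk_mul]
  change weight g α (fun c => classLength Γ (outAct p.out⁻¹ c)) = _
  rw [p.out_inv]

theorem norm_move_add (α : OutL Γ) (p : DegenerateOrWhiteheadPair Γ) :
    (mk (α * p.outL)).norm g + weight g α (classCount Γ p.m.1) =
      (mk α).norm g + weight g α (classCrossings Γ p.P p.m.1) := by
  rw [norm_mk_mul_outL, norm_mk, ← weight_add, ← weight_add]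
  congr 1
  ext c
  rw [p.classLength_outAct_add, p.classCount_outAct_self]

/-- The change of norm is the weight of the crossings minus the weight of the base vertex, and the
ordered group allows cancellation. -/
theorem norm_move_lt_iff (α : OutL Γ) (p : DegenerateOrWhiteheadPair Γ) :
    (mk (α * p.outL)).norm g < (mk α).norm g ↔
      weight g α (classCrossings Γ p.P p.m.1) < weight g α (classCount Γ p.m.1) := by
  have h := norm_move_add (g := g) α p
  rw [← add_lt_add_iff_right (weight g α (classCount Γ p.m.1)), h, add_lt_add_iff_left]

/-- The second move changes only the count at the base vertex of `q`. Neither `p` nor `r` alters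
that count, so `q` changes the length by the same amount before and after `p`. -/
theorem norm_square (α : OutL Γ) (p q r : DegenerateOrWhiteheadPair Γ)
    (h : p.out * q.out = q.out * r.out) (hr : r.m.1 = p.m.1) (hpq : p.m.1 ≠ q.m.1) :
    (mk (α * p.outL * q.outL)).norm g + (mk α).norm g =
      (mk (α * p.outL)).norm g + (mk (α * q.outL)).norm g := by
  have h' : q.out * p.out = r.out * q.out := by
    have := congrArg (·⁻¹) h
    simpa [DegenerateOrWhiteheadPair.out_inv] using this
  have h1 : (mk (α * p.outL * q.outL)).norm g =
      weight g α fun c => classLength Γ (outAct q.out (outAct p.out c)) := by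
    have e : ((p.outL * q.outL : OutL Γ) : Out (RAAG Γ))⁻¹ = q.out * p.out := by
      rw [Subgroup.coe_mul, mul_inv_rev]
      exact congrArg₂ (· * ·) q.out_inv p.out_inv
    rw [mul_assoc, norm_mk_mul, e]
    simp only [outAct_mul]
  rw [h1, norm_mk, norm_mk_mul_outL, norm_mk_mul_outL, ← weight_add, ← weight_add]
  congr 1
  ext c
  have e1 := q.classLength_outAct_add (outAct p.out c)
  have e2 := q.classLength_outAct_add c
  rw [p.classCount_outAct_of_ne hpq.symm] at e1
  have e3 : classCount Γ q.m.1 (outAct q.out (outAct p.out c)) =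
      classCount Γ q.m.1 (outAct q.out c) := by
    rw [← outAct_mul, h', outAct_mul, r.classCount_outAct_of_ne (by rw [hr]; exact hpq.symm)]
  omega

/-! ### Paths of moves below a given norm -/

variable (g) in
/-- A move between marked Salvettis of norm less than `B`. -/
def StepBelow (B : ℤ ×ₗ Lex (ℕ → ℤ)) (σ τ : MarkedSalvetti Γ) : Prop :=
  σ.IsMove τ ∧ σ.norm g < B ∧ τ.norm g < B

variable (g) in
/-- Whitehead paths through marked Salvettis of norm less than `B`. -/
abbrev PathBelow (B : ℤ ×ₗ Lex (ℕ → ℤ)) : MarkedSalvetti Γ → MarkedSalvetti Γ → Prop :=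
  Relation.ReflTransGen (StepBelow g B)

variable {B : ℤ ×ₗ Lex (ℕ → ℤ)}

theorem isMove_symm {σ τ : MarkedSalvetti Γ} (h : σ.IsMove τ) : τ.IsMove σ := by
  obtain ⟨α, p, rfl, rfl⟩ := h
  refine ⟨α * p.toOutL, p, rfl, ?_⟩
  have : p.toOutL * p.toOutL = 1 := Subtype.ext p.out_mul_self
  rw [move, mul_assoc, this, mul_one]

theorem PathBelow.symm {σ τ : MarkedSalvetti Γ} (h : PathBelow g B σ τ) : PathBelow g B τ σ := by
  induction h with
  | refl => exact .refl
  | tail _ h ih => exact .head ⟨isMove_symm h.1, h.2.2, h.2.1⟩ ih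

/-- A singleton pair is an inversion and does not move the marked Salvetti. Corners and differences
may therefore be degenerate without special treatment. -/
theorem pathBelow_move (α : OutL Γ) (p : DegenerateOrWhiteheadPair Γ) (h : (mk α).norm g < B)
    (h' : (mk (α * p.outL)).norm g < B) : PathBelow g B (mk α) (mk (α * p.outL)) := by
  by_cases hp : p.P.Nontrivial
  · exact .single ⟨⟨α, ⟨p, hp⟩, rfl, rfl⟩, h, h'⟩
  · have hP : p.P = {p.m} :=
      (Set.not_nontrivial_iff.1 hp).eq_singleton_of_mem p.m_mem
    have : p.aut = (DegenerateOrWhiteheadPair.inv Γ p.m).aut := by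
      refine aut_ext fun v => ?_
      rw [DegenerateOrWhiteheadPair.aut_gen, DegenerateOrWhiteheadPair.aut_gen, hP]
      rfl
    rw [mk_mul_of_mem α (Subgroup.subset_closure
      ⟨_, Or.inr (DegenerateOrWhiteheadPair.isInversion_inv p.m), by rw [← this]; rfl⟩)]

theorem outL_compl (p : DegenerateOrWhiteheadPair Γ) : p.compl.outL = p.outL :=
  Subtype.ext p.out_compl

/-! ### Elementary ways to connect two reductive moves -/

section

variable {α : OutL Γ} {p q : DegenerateOrWhiteheadPair Γ}

variable (g α p) in
/-- The move given by a pair reduces the norm. -/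
def Reductive : Prop := (mk (α * p.outL)).norm g < (mk α).norm g

variable (g α p q) in
/-- The results of two moves are connected by a path below the initial norm. -/
def Connected : Prop := PathBelow g ((mk α).norm g) (mk (α * p.outL)) (mk (α * q.outL))

theorem reductive_compl : Reductive g α p.compl ↔ Reductive g α p := by
  rw [Reductive, outL_compl, Reductive]

theorem connected_compl_left : Connected g α p.compl q ↔ Connected g α p q := by
  rw [Connected, outL_compl, Connected]

theorem connected_compl_right : Connected g α p q.compl ↔ Connected g α p q := by
  rw [Connected, outL_compl, Connected]

theorem Connected.symm (h : Connected g α p q) : Connected g α q p := PathBelow.symm h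

theorem Connected.trans {r : DegenerateOrWhiteheadPair Γ} (h : Connected g α p q)
    (h' : Connected g α q r) : Connected g α p r := Relation.ReflTransGen.trans h h'

/-- The results differ by the move of the difference pair, taken from the representative adjusted by
inversion of the base. -/
theorem connected_of_subset (hp : Reductive g α p) (hq : Reductive g α q) (hm : p.m = q.m)
    (h : p.P ⊆ q.P) : Connected g α p q := by
  let i : OutL Γ := (DegenerateOrWhiteheadPair.inv Γ q.m).outL
  have hi : mk (α * p.outL * i) = mk (α * p.outL) := mk_mul_of_mem _ (Subgroup.subset_closure
    ⟨_, Or.inr (DegenerateOrWhiteheadPair.isInversion_inv q.m), rfl⟩)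
  have he : α * q.outL = α * p.outL * i * (p.diff q hm).outL := by
    rw [mul_assoc, mul_assoc]
    congr 1
    refine Subtype.ext ?_
    change q.out = p.out * (_ * _)
    rw [DegenerateOrWhiteheadPair.out, p.aut_diff q hm h, map_mul, map_mul, mul_assoc]
    rfl
  have := pathBelow_move (g := g) (B := (mk α).norm g) (α * p.outL * i) (p.diff q hm)
    (by rw [hi]; exact hp) (by rw [← he]; exact hq)
  rwa [hi, ← he] at this

theorem connected_rebase (w : V × Bool) (hw : w ∈ p.P) (hw' : letterInv w ∉ p.P)
    (hl : ∀ y, Γ.Adj y p.m.1 ↔ Γ.Adj y w.1) (hne : p.m.1 ≠ w.1) (hp : Reductive g α p)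
    (hq : Reductive g α (p.rebase w hw hw' hl)) : Connected g α p (p.rebase w hw hw' hl) := by
  obtain ⟨h, hh, e⟩ := p.out_mul_out_rebase w hw hw' hl hne
  have e' : mk (α * p.outL * (p.rebase w hw hw' hl).outL) =
      mk (α * (p.rebase w hw hw' hl).outL) := by
    refine (QuotientGroup.eq.2 (Subgroup.mem_subgroupOf.2 ?_)).symm
    change ((α : Out (RAAG Γ)) * (p.rebase w hw hw' hl).out)⁻¹ *
      (α * p.out * (p.rebase w hw hw' hl).out) ∈ salvettiIso Γ
    rw [mul_assoc, e]
    simpa using hh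
  have := pathBelow_move (g := g) (B := (mk α).norm g) (α * p.outL) (p.rebase w hw hw' hl) hp
    (by rw [e']; exact hq)
  rwa [e'] at this

/-- With equal links the crossing numbers agree, and passing to a base vertex of no smaller weight
only helps. -/
theorem reductive_rebase (w : V × Bool) (hw : w ∈ p.P) (hw' : letterInv w ∉ p.P)
    (hl : ∀ y, Γ.Adj y p.m.1 ↔ Γ.Adj y w.1) (hp : Reductive g α p)
    (hle : weight g α (classCount Γ p.m.1) ≤ weight g α (classCount Γ w.1)) :
    Reductive g α (p.rebase w hw hw' hl) := by
  rw [Reductive, norm_move_lt_iff] at hp ⊢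
  have e : classCrossings Γ (p.rebase w hw hw' hl).P (p.rebase w hw hw' hl).m.1 =
      classCrossings Γ p.P p.m.1 := funext fun c => (classCrossings_congr hl c).symm
  rw [e]
  exact hp.trans_le hle

/-- By the parallelogram identity the fourth vertex has norm less than that of `σ`, so the path runs
around the square through it. -/
theorem connected_of_square (r : DegenerateOrWhiteheadPair Γ)
    (h : p.out * q.out = q.out * r.out) (hr : r.m.1 = p.m.1) (hpq : p.m.1 ≠ q.m.1)
    (hp : Reductive g α p) (hq : Reductive g α q) : Connected g α p q := by
  have hn := norm_square (g := g) α p q r h hr hpq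
  have hlt : (mk (α * p.outL * q.outL)).norm g < (mk α).norm g := by
    have := add_lt_add hp hq
    rw [← hn] at this
    exact lt_of_add_lt_add_right this
  have e : α * p.outL * q.outL = α * q.outL * r.outL := by
    rw [mul_assoc, mul_assoc]
    congr 1
    exact Subtype.ext h
  refine (pathBelow_move (g := g) (α * p.outL) q hp hlt).trans (PathBelow.symm ?_)
  rw [e] at hlt ⊢
  exact pathBelow_move (α * q.outL) r hq hlt

theorem connected_of_adj (h : Γ.Adj p.m.1 q.m.1) (hp : Reductive g α p) (hq : Reductive g α q) :
    Connected g α p q :=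
  connected_of_square p (p.out_commute q h.ne (fun h' => q.not_adj _ h' h)
    (fun h' => q.not_adj _ h' h) (fun h' => p.not_adj _ h' h.symm)
    (fun h' => p.not_adj _ h' h.symm) (Or.inl h)) rfl h.ne hp hq

/-- Disjointness forces the bases to be mutually inverse, and `P` is contained in the complement of
`Q`. -/
theorem connected_of_disjoint_of_eq (h : p.m.1 = q.m.1) (hd : Disjoint p.P q.P)
    (hp : Reductive g α p) (hq : Reductive g α q) : Connected g α p q := by
  rw [← connected_compl_right]
  refine connected_of_subset hp (reductive_compl.2 hq) ?_ fun x hx => ?_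
  · rcases DegenerateOrWhiteheadPair.fst_eq_iff.1 h with h | h
    · exact absurd q.m_mem (Set.disjoint_left.1 hd (h ▸ p.m_mem))
    · exact h
  · exact ⟨Set.disjoint_left.1 hd hx, h ▸ p.not_adj x hx⟩

end

/-! ### Case analysis on the positions of the bases -/

section

variable {α : OutL Γ} {p q : DegenerateOrWhiteheadPair Γ}

/-- If each of the bases is split by the other pair, then one of the pairs may be replaced by a
pair that has the same base vertex as the other one. -/
theorem connected_of_split (b c : V × Bool) (hb : b.1 = p.m.1) (hc : c.1 = q.m.1)
    (hbq : b ∈ q.P) (hbq' : letterInv b ∉ q.P) (hcp : c ∈ p.P) (hcp' : letterInv c ∉ p.P)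
    (hne : p.m.1 ≠ q.m.1) (hp : Reductive g α p) (hq : Reductive g α q)
    (h1 : ∀ r : DegenerateOrWhiteheadPair Γ, r.P = q.P → r.m = b → Reductive g α r →
      Connected g α p r)
    (h2 : ∀ r : DegenerateOrWhiteheadPair Γ, r.P = p.P → r.m = c → Reductive g α r →
      Connected g α r q) : Connected g α p q := by
  have hl : ∀ y, Γ.Adj y p.m.1 ↔ Γ.Adj y q.m.1 := fun y => by
    constructor
    · intro h
      exact q.adj_base_of_split hbq hbq' (hb ▸ h)
    · intro h
      exact p.adj_base_of_split hcp hcp' (hc ▸ h)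
  -- Mutual splitting makes the links equal. The pair whose base vertex has the smaller weight is
  -- rebased at the other vertex and stays reductive.
  rcases le_total (weight g α (classCount Γ q.m.1)) (weight g α (classCount Γ p.m.1)) with h | h
  · have hl' : ∀ y, Γ.Adj y q.m.1 ↔ Γ.Adj y b.1 := fun y => by rw [hb, hl]
    have hr := reductive_rebase b hbq hbq' hl' hq (by rwa [hb])
    exact (h1 (q.rebase b hbq hbq' hl') rfl rfl hr).trans
      (connected_rebase b hbq hbq' hl' (by rw [hb]; exact hne.symm) hq hr).symm
  · have hl' : ∀ y, Γ.Adj y p.m.1 ↔ Γ.Adj y c.1 := fun y => by rw [hc, hl]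
    have hr := reductive_rebase c hcp hcp' hl' hp (by rwa [hc])
    exact (connected_rebase c hcp hcp' hl' (by rwa [hc]) hp hr).trans 
      (h2 (p.rebase c hcp hcp' hl') rfl rfl hr)

/-- The cases depend on which inverse bases lie in the other set: both gives mutual splitting,
exactly one gives the union square, neither gives a commuting square. -/
theorem connected_of_disjoint (h : ¬ Γ.Adj p.m.1 q.m.1) (hd : Disjoint p.P q.P)
    (hp : Reductive g α p) (hq : Reductive g α q) : Connected g α p q := by
  by_cases hne : p.m.1 = q.m.1
  · exact connected_of_disjoint_of_eq hne hd hp hq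
  have hpq : p.m ∉ q.P := Set.disjoint_left.1 hd p.m_mem
  have hqp : q.m ∉ p.P := Set.disjoint_right.1 hd q.m_mem
  by_cases h1 : letterInv p.m ∈ q.P <;> by_cases h2 : letterInv q.m ∈ p.P
  · refine connected_of_split (letterInv p.m) (letterInv q.m) rfl rfl h1
      (by rwa [letterInv_letterInv]) h2 (by rwa [letterInv_letterInv]) hne hp hq ?_ ?_
    · intro r hrP hrm hr
      exact connected_of_disjoint_of_eq (by rw [hrm]; rfl) (by rwa [hrP]) hp hr
    · intro r hrP hrm hr
      exact connected_of_disjoint_of_eq (by rw [hrm]; rfl) (by rwa [hrP]) hr hq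
  · exact (connected_of_square _ (q.out_union p (fun h' => h h'.symm) (Ne.symm hne) hd.symm h1 h2)
      rfl (Ne.symm hne) hq hp).symm
  · exact connected_of_square _ (p.out_union q h hne hd h2 h1) rfl hne hp hq
  · exact connected_of_square p (p.out_commute q hne hpq h1 hqp h2 (Or.inr hd)) rfl hne hp hq

/-- The corner is nested in `P` with the same base and disjoint from the complement of `Q`, so it
serves as an intermediate move. -/
theorem connected_of_reductive_corner (h1 : p.m ∈ q.P) (h2 : letterInv q.m ∉ p.P)
    (h : ¬ Γ.Adj p.m.1 q.m.1) (hp : Reductive g α p) (hq : Reductive g α q)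
    (hc : Reductive g α (p.corner q h1 h2 h)) : Connected g α p q := by
  refine (connected_of_subset hc hp rfl fun x hx => hx.1).symm.trans ?_
  rw [← connected_compl_right]
  refine connected_of_disjoint h ?_ hc (reductive_compl.2 hq)
  exact Set.disjoint_left.2 fun x hx hx' => hx'.1 hx.2

/-- By submodularity one of the two opposite corners has crossings below the weight of its base. If
it is the second, the same argument runs with complements and the roles exchanged. -/
theorem connected_of_mem (h1 : p.m ∈ q.P) (h2 : letterInv q.m ∉ p.P)
    (h : ¬ Γ.Adj p.m.1 q.m.1) (hp : Reductive g α p) (hq : Reductive g α q) :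
    Connected g α p q := by
  have hle := weight_mono (g := g) α (p.classCrossings_corner_add_le q h1 h2 h)
  rw [weight_add, weight_add] at hle
  have hlt := add_lt_add ((norm_move_lt_iff α p).1 hp) ((norm_move_lt_iff α q).1 hq)
  rcases lt_or_lt_of_add_lt_add (hle.trans_lt hlt) with hc | hc
  · exact connected_of_reductive_corner h1 h2 h hp hq ((norm_move_lt_iff α _).2 hc)
  · have := connected_of_reductive_corner (p := q.compl) (q := p.compl)
      ⟨h2, fun h' => h h'.symm⟩
      (fun h' => h'.1 (by rw [DegenerateOrWhiteheadPair.compl_m, letterInv_letterInv]; exact h1))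
      (fun h' => h h'.symm) (reductive_compl.2 hq) (reductive_compl.2 hp)
      ((norm_move_lt_iff α _).2 hc)
    rw [connected_compl_left, connected_compl_right] at this
    exact this.symm

/-- Replacing sets by complements, any pair of opposite corners with one containing a letter of
`p`'s base vertex and the other a letter of `q`'s can be used; `key` lists the four possibilities.
They fail only when the letters of `p`'s base occupy one diagonal of the four corners and those of
`q`'s base the other, in one of two arrangements; each base is then split by the other set. -/
theorem connected_of_not_adj (h : ¬ Γ.Adj p.m.1 q.m.1) (hp : Reductive g α p)
    (hq : Reductive g α q) : Connected g α p q := by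
  have h' : ¬ Γ.Adj q.m.1 p.m.1 := fun h' => h h'.symm
  have key : ∀ p q : DegenerateOrWhiteheadPair Γ, ¬ Γ.Adj p.m.1 q.m.1 → Reductive g α p →
      Reductive g α q → (p.m ∈ q.P ∧ letterInv q.m ∉ p.P) ∨
      (letterInv p.m ∈ q.P ∧ letterInv q.m ∈ p.P) ∨ (p.m ∉ q.P ∧ q.m ∉ p.P) ∨
      (letterInv p.m ∉ q.P ∧ q.m ∈ p.P) → Connected g α p q := by
    intro p q h hp hq hc
    have h' : ¬ Γ.Adj q.m.1 p.m.1 := fun h' => h h'.symm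
    rcases hc with hc | hc | hc | hc
    · exact connected_of_mem hc.1 hc.2 h hp hq
    · rw [← connected_compl_left]
      exact connected_of_mem hc.1 (fun h'' => h''.1 hc.2) h (reductive_compl.2 hp) hq
    · rw [← connected_compl_right]
      exact connected_of_mem ⟨hc.1, h⟩
        (by rw [DegenerateOrWhiteheadPair.compl_m, letterInv_letterInv]; exact hc.2) h hp
        (reductive_compl.2 hq)
    · exact (connected_of_mem hc.2 hc.1 h' hq hp).symm
  by_cases hne : p.m.1 = q.m.1
  · refine key p q h hp hq ?_
    have a1 := p.m_mem
    have a2 := q.m_mem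
    have a3 := p.letterInv_m_notMem
    have a4 := q.letterInv_m_notMem
    rcases DegenerateOrWhiteheadPair.fst_eq_iff.1 hne with e | e
    · exact Or.inl ⟨e ▸ a2, e ▸ a3⟩
    · refine Or.inr (Or.inl ⟨?_, e ▸ a1⟩)
      rw [e, letterInv_letterInv]
      exact a2
  by_cases hb : p.m ∈ q.P ∧ letterInv q.m ∈ p.P ∧ letterInv p.m ∉ q.P ∧ q.m ∉ p.P
  · obtain ⟨b1, b2, b3, b4⟩ := hb
    refine connected_of_split p.m (letterInv q.m) rfl rfl b1 b3 b2
      (by rwa [letterInv_letterInv]) hne hp hq (fun r hrP hrm hr => ?_) fun r hrP hrm hr => ?_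
    · refine key p r (by rw [hrm]; exact Γ.irrefl) hp hr (Or.inl ⟨by rwa [hrP], ?_⟩)
      rw [hrm]
      exact p.letterInv_m_notMem
    · refine key r q (by rw [hrm]; exact Γ.irrefl) hr hq (Or.inr (Or.inr (Or.inl ⟨?_, ?_⟩)))
      · rw [hrm]
        exact q.letterInv_m_notMem
      · rwa [hrP]
  by_cases hb' : p.m ∉ q.P ∧ letterInv q.m ∉ p.P ∧ letterInv p.m ∈ q.P ∧ q.m ∈ p.P
  · obtain ⟨b1, b2, b3, b4⟩ := hb'
    refine connected_of_split (letterInv p.m) q.m rfl rfl b3 (by rwa [letterInv_letterInv]) b4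
      b2 hne hp hq (fun r hrP hrm hr => ?_) fun r hrP hrm hr => ?_
    · refine key p r (by rw [hrm]; exact Γ.irrefl) hp hr (Or.inr (Or.inl ⟨by rwa [hrP], ?_⟩))
      rw [hrm, letterInv_letterInv]
      exact p.m_mem
    · refine key r q (by rw [hrm]; exact Γ.irrefl) hr hq (Or.inl ⟨?_, by rwa [hrP]⟩)
      rw [hrm]
      exact q.m_mem
  exact key p q h hp hq (by tauto)

theorem connected_of_reductive (hp : Reductive g α p) (hq : Reductive g α q) :
    Connected g α p q := by
  by_cases h : Γ.Adj p.m.1 q.m.1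
  · exact connected_of_adj h hp hq
  · exact connected_of_not_adj h hp hq

end

/-! ### Change of representative and extraction of paths -/

/-- The two representatives differ by an isomorphism of the Salvetti complex, and conjugating a
Whitehead automorphism by it gives another one. -/
theorem exists_outL_of_mk_eq {α β : OutL Γ} (h : mk α = mk β) (q : DegenerateOrWhiteheadPair Γ) :
    ∃ q' : DegenerateOrWhiteheadPair Γ, mk (β * q.outL) = mk (α * q'.outL) := by
  have hh : ((α⁻¹ * β : OutL Γ) : Out (RAAG Γ)) ∈ salvettiIso Γ :=
    Subgroup.mem_subgroupOf.1 (QuotientGroup.eq.1 h)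
  obtain ⟨q', e⟩ := (DegenerateOrWhiteheadPair.exists_conj_out hh q).1
  refine ⟨q', ?_⟩
  have e' : α * q'.outL = β * q.outL * (α⁻¹ * β)⁻¹ := by
    have : q'.outL = (α⁻¹ * β) * q.outL * (α⁻¹ * β)⁻¹ := Subtype.ext e.symm
    rw [this]
    group
  rw [e']
  exact (mk_mul_of_mem _ (inv_mem hh)).symm

theorem exists_path {σ τ : MarkedSalvetti Γ} (h : PathBelow g B σ τ) (hσ : σ.norm g < B) :
    ∃ (n : ℕ) (f : ℕ → MarkedSalvetti Γ), f 0 = σ ∧ f n = τ ∧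
      (∀ i < n, (f i).IsMove (f (i + 1))) ∧ ∀ i ≤ n, (f i).norm g < B := by
  induction h with
  | refl => exact ⟨0, fun _ => σ, rfl, rfl, by simp, fun _ _ => hσ⟩
  | @tail ρ τ _ h ih =>
    obtain ⟨n, f, h0, hn, h1, h2⟩ := ih
    refine ⟨n + 1, fun i => if i ≤ n then f i else τ, by simp [h0], by simp, fun i hi => ?_,
      fun i hi => ?_⟩
    · rcases Nat.lt_succ_iff_lt_or_eq.1 hi with hi | rfl
      · simpa [hi.le, Nat.succ_le_iff.2 hi] using h1 i hi
      · simpa [hn] using h.1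
    · by_cases hi' : i ≤ n
      · simpa [hi'] using h2 i hi'
      · simpa [hi'] using h.2.2

end MarkedSalvetti

end RAAG

end

theorem mainTheorem3 {V : Type u} [Finite V] (Γ : SimpleGraph V)
    (g : ℕ → ConjClasses (RAAG Γ)) (hg : Function.Surjective g)
    (σ : RAAG.MarkedSalvetti Γ) (α β : RAAG.OutL Γ)
    (hα : RAAG.MarkedSalvetti.mk α = σ) (hβ : RAAG.MarkedSalvetti.mk β = σ)
    (p q : RAAG.WhiteheadPair Γ)
    (hp : (RAAG.MarkedSalvetti.move α p).norm g < σ.norm g)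
    (hq : (RAAG.MarkedSalvetti.move β q).norm g < σ.norm g) :
    ∃ (n : ℕ) (τ : ℕ → RAAG.MarkedSalvetti Γ),
      τ 0 = RAAG.MarkedSalvetti.move α p ∧ τ n = RAAG.MarkedSalvetti.move β q ∧
      (∀ i < n, (τ i).IsMove (τ (i + 1))) ∧
      ∀ i ≤ n, (τ i).norm g < σ.norm g := by
  subst hα
  -- The second move is rewritten as a move from the representative used for the first.
  obtain ⟨q', e⟩ := RAAG.MarkedSalvetti.exists_outL_of_mk_eq hβ.symm
    q.toDegenerateOrWhiteheadPair
  change RAAG.MarkedSalvetti.move β q = _ at e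
  rw [e] at hq ⊢
  exact RAAG.MarkedSalvetti.exists_path (RAAG.MarkedSalvetti.connected_of_reductive
    (p := p.toDegenerateOrWhiteheadPair) hp hq) hp
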